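/- **Theorem (Seq interprets Seq⁺).** Consider the first-order language with a constant $e$ and binary function symbols $\vdash$ and $\circ$ (write $xy$ for $x\circ y$). Let $\mathsf{Seq}$ be the theory with axioms 1. $\forall xy\,[\,x\vdash y\neq e\,]$, 2. $\forall x_1x_2y_1y_2\,[\,x_1\vdash x_2=y_1\vdash y_2\rightarrow(x_1=y_1\wedge x_2=y_2)\,]$, 3. $\forall x\,[\,x e=x\,]$, 4. $\forall xyz\,[\,x\circ(y\vdash z)=(x\circ y)\vdash z\,]$, 5. $\forall x\,[\,x=e\vee\exists yz\,[\,x=y\vdash z\,]\,]$, and let $\mathsf{Seq}^+$ be $\mathsf{Seq}$ together with - $\mathsf{Seq}^*_3$: $\forall x\,[\,xe=x\wedge ex=x\,]$, - $\mathsf{Seq}^*_5$: $\forall xyzw\,[\,xy=zw\leftrightarrow\exists u\,[(z=xu\wedge uw=y)\vee(x=zu\wedge uy=w)]\,]$, - $\mathsf{Seq}^+_c$: $\forall xyz\,[\,(xy=xz\vee yx=zx)\rightarrow y=z\,]$. Then $\mathsf{Seq}$ interprets $\mathsf{Seq}^+$: there is a translation $\tau$, given by a domain formula $\delta$ and formulas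 defining the graphs of $e^\tau,\vdash^\tau,\circ^\tau$ (equality is translated as equality, compound terms are unnested, quantifiers are relativised to $\delta$), such that $\mathsf{Seq}$ proves that the domain is nonempty, that $e^\tau,\vdash^\tau,\circ^\tau$ are total functions on the domain, and $\varphi^\tau$ for every axiom $\varphi$ of $\mathsf{Seq}^+$. (Here "$T$ proves $\varphi$" means that $\varphi$ holds in all models of $T$.) Moreover $\tau$ can be chosen of the following form. There are classes (formulas with one free variable) $\mathcal J\supseteq\mathsf N\supseteq\mathsf N^\star$ such that the following holds provably in $\mathsf{Seq}$. - $\mathcal J$ contains $e$, is closed under $\vdash$ and $\circ$, and axioms 1, 2, 4, $\mathsf{Seq}^*_3$, $\mathsf{Seq}^*_5$ hold restricted to $\mathcal J$; $e\vdash w\in\mathcal J$ for all $w$; the relation $x\preceq y:\Leftrightarrow\exists z\in\mathcal J\,[y=xz]$ is reflexive and transitive, and $\mathcal J$ is downward closed under it. - Let $0:=e$, $\mathrm Sx:=x\vdash e$, $x+y:=xy$, let $x\le y$ mean $\exists z\in\mathsf N\,[x+z=y]$, and let $x<y$ mean $x\le y\wedge x\neq y$. $\mathsf N$ contains $0$ and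 is closed under $\mathrm S$ and $+$; on $\mathsf N$, $\mathrm S$ is one-to-one, $0$ is not a successor, every nonzero element has a predecessor, $x+0=x$, $x+\mathrm Sy=\mathrm S(x+y)$, addition is associative, commutative and cancellative, $\le$ is a linear order with least element $0$, and $x\le\mathrm Sy\leftrightarrow(x=\mathrm Sy\vee x\le y)$; $\mathsf N$ is downward closed under $\le$. The subclass $\mathsf N^\star$ contains $0$, is closed under $\mathrm S,+$ and is downward closed under $\le$. - Write $(k,u)$ for $k\vdash u$. An *indexed sequence* $f:[m,n]\to\mathcal J$ is an $f\in\mathcal J$ with $m,n\in\mathsf N$, $m\le n$, such that: (1) for each $m\le k\le n$ there are $u,s,t\in\mathcal J$ with $f=(s\vdash(k,u))\,t$; (2) if $f=(s\vdash w)\,t$ with $s,t\in\mathcal J$ and $w$ arbitrary, then $w=(k,u)$ for some $m\le k\le n$ and $u\in\mathcal J$; (3) if $f=(s\vdash(k,u))\,t$ with $s,t,k,u\in\mathcal J$ and $s\neq e$, then $m<k$ and there are $\ell,v,s_0\in\mathcal J$ with $k=\mathrm S\ell$ and $s=s_0\vdash(\ell,v)$; (4) if $f=(s\vdash(k,u))\,t$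 with $s,t,k,u\in\mathcal J$, then there are no $k'\in\mathsf N$ with $k\le k'$ and $u',s_0,t_0\in\mathcal J$ with $s=(s_0\vdash(k',u'))\,t_0$. We write $f(k)=u$ if $u\in\mathcal J$ and $f=(s\vdash(k,u))\,t$ for some $s,t\in\mathcal J$. - The domain of $\tau$ consists exactly of $e$ and of all indexed sequences $f:[0,n]\to\mathcal J$ with $n\in\mathsf N^\star$. - $e^\tau=e$. - $f\circ^\tau g=f^\frown g$, where $e^\frown g=g$, $f^\frown e=f$, and for $f:[0,n]\to\mathcal J$, $g:[0,m]\to\mathcal J$ the indexed sequence $f^\frown g:[0,n+m+1]\to\mathcal J$ is $f\circ g'$ with $g':[n+1,n+1+m]\to\mathcal J$ the shift of $g$ ($g'(n+1+j)=g(j)$ for $j\le m$), so that $(f^\frown g)(j)=f(j)$ for $j\le n$ and $(f^\frown g)(n+1+j)=g(j)$ for $j\le m$. - $f\vdash^\tau g$ is $f^\frown\frac{x}{[0,0]}$ for some $x\in\mathcal J$, where $\frac{x}{[0,0]}=e\vdash(0,x)$. -/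

import Mathlib

open FirstOrder FirstOrder.Language

namespace SeqInterp

/-! ### Relative interpretations between first-order theories -/

/-- A (one-dimensional, relative, equality-preserving) translation of the language `L` into the
language `L'`: a domain formula, and for every symbol of `L` a formula of `L'`. In the formula for
an `n`-ary function symbol, variable `0` is the value and variables `1, …, n` are the arguments. -/
structure Translation (L L' : FirstOrder.Language.{0, 0}) where
  dom : L'.Formula (Fin 1)
  fn : ∀ {n : ℕ}, L.Functions n → L'.Formula (Fin (n + 1))
  rel : ∀ {n : ℕ}, L.Relations n → L'.Formula (Fin n)

namespace Translation

variable {L L' : FirstOrder.Language.{0, 0}} (τ : Translation L L') {α : Type}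

/-- The variable `a` belongs to the domain. -/
def inDom (a : α) : L'.Formula α :=
  τ.dom.relabel (fun _ => a)

/-- There are `y₀, …, yₙ₋₁` in the domain that satisfy `φ`; here `yᵢ` is the variable
`Sum.inr i` of `φ`. -/
noncomputable def exDom (n : ℕ) (φ : L'.Formula (α ⊕ Fin n)) : L'.Formula α :=
  Formula.iExs (Fin n) ((Formula.iInf fun i : Fin n => τ.inDom (Sum.inr i)) ⊓ φ)

/-- The translation of the formula `t = v`, where the fresh variable `v` is `none`. Compound terms
are unnested, the intermediate values ranging over the domain. -/
noncomputable def termGraph : L.Term α → L'.Formula (Option α)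
  | .var a => Term.equal (Term.var (some a)) (Term.var none)
  | .func (l := n) f ts =>
      τ.exDom n <|
        (Formula.iInf fun i : Fin n =>
          (termGraph (ts i)).relabel
            (fun o => o.elim (Sum.inr i) (fun a => Sum.inl (some a)))) ⊓
        (τ.fn f).relabel (Fin.cons (Sum.inl none) Sum.inr)

/-- The translation of the formula `P(t₀, …, tₙ₋₁)`, where `P` has been translated to `ψ`: there
are values `yᵢ` of the terms `tᵢ` in the domain that satisfy `ψ`. -/
noncomputable def atomic {n : ℕ} (ψ : L'.Formula (Fin n)) (ts : Fin n → L.Term α) :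
    L'.Formula α :=
  τ.exDom n <|
    (Formula.iInf fun i : Fin n =>
      (τ.termGraph (ts i)).relabel (fun o => o.elim (Sum.inr i) Sum.inl)) ⊓
    ψ.relabel Sum.inr

/-- A formula in the free variables `α` and `n` further free variables, viewed as a formula in
which the latter are the variables `&0, …, &(n-1)`. -/
def toBounded {n : ℕ} (φ : L'.Formula (α ⊕ Fin n)) : L'.BoundedFormula α n :=
  BoundedFormula.relabel (n := n) (k := 0) id φ

/-- The translation of formulas: it commutes with the connectives, and quantifiers are relativised
to the domain. -/
noncomputable def translate : ∀ {n : ℕ}, L.BoundedFormula α n → L'.BoundedFormula α n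
  | _, .falsum => .falsum
  | _, .equal t₁ t₂ =>
      toBounded (τ.atomic (Term.equal (Term.var 0) (Term.var 1)) ![t₁, t₂])
  | _, .rel R ts => toBounded (τ.atomic (τ.rel R) ts)
  | _, .imp φ ψ => (translate φ).imp (translate ψ)
  | n, .all φ => (BoundedFormula.imp (toBounded (τ.inDom (Sum.inr (Fin.last n)))) (translate φ)).all

/-- The `L'`-formula expressing that the domain is nonempty. -/
noncomputable def domNonempty : L'.Sentence :=
  Formula.iExs (Fin 1) (τ.inDom (Sum.inr 0))

/-- The `L'`-formula (in the variables `x₀, …, xₙ₋₁`) expressing: if all `xᵢ` are in the domain,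
then there is exactly one `y` in the domain that is a value of `f` at `x₀, …, xₙ₋₁`. -/
noncomputable def functional {n : ℕ} (f : L.Functions n) : L'.Formula (Fin n) :=
  (Formula.iInf fun i : Fin n => τ.inDom i) ⟹
    Formula.iExsUnique Unit
      (τ.inDom (Sum.inr ()) ⊓ (τ.fn f).relabel (Fin.cons (Sum.inr ()) Sum.inl))

/-- `τ` is an interpretation of the `L`-theory `U` in the `L'`-theory `T`: the theory `T` proves
that the domain is nonempty, that every function symbol is interpreted by a function on the domain,
and the translation of every axiom of `U`. -/
def IsInterpretation (T : L'.Theory) (U : L.Theory) : Prop :=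
  T ⊨ᵇ τ.domNonempty ∧
  (∀ (n : ℕ) (f : L.Functions n), T ⊨ᵇ τ.functional f) ∧
  ∀ φ ∈ U, T ⊨ᵇ τ.translate φ

end Translation

/-! ### The language and the theories -/

inductive SeqFunc : ℕ → Type
  | e : SeqFunc 0
  | snoc : SeqFunc 2
  | cat : SeqFunc 2

/-- The language with a constant `e` and binary function symbols `⊢` (`snoc`) and `∘` (`cat`). -/
def LSeq : FirstOrder.Language.{0, 0} := ⟨SeqFunc, fun _ => Empty⟩

section Terms

variable {α : Type}

def eT : LSeq.Term α := Constants.term (L := LSeq) SeqFunc.e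

def snocT (s t : LSeq.Term α) : LSeq.Term α := Functions.apply₂ (L := LSeq) SeqFunc.snoc s t

def catT (s t : LSeq.Term α) : LSeq.Term α := Functions.apply₂ (L := LSeq) SeqFunc.cat s t

end Terms

/-- `∀ x y, x ⊢ y ≠ e` -/
def seq1 : LSeq.Sentence := ∀' ∀' ∼(snocT &0 &1 =' eT)

/-- `∀ x₁ x₂ y₁ y₂, x₁ ⊢ x₂ = y₁ ⊢ y₂ → x₁ = y₁ ∧ x₂ = y₂` -/
def seq2 : LSeq.Sentence :=
  ∀' ∀' ∀' ∀' ((snocT &0 &1 =' snocT &2 &3) ⟹ ((&0 =' &2) ⊓ (&1 =' &3)))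

/-- `∀ x, x ∘ e = x` -/
def seq3 : LSeq.Sentence := ∀' (catT &0 eT =' &0)

/-- `∀ x y z, x ∘ (y ⊢ z) = (x ∘ y) ⊢ z` -/
def seq4 : LSeq.Sentence := ∀' ∀' ∀' (catT &0 (snocT &1 &2) =' snocT (catT &0 &1) &2)

/-- `∀ x, x = e ∨ ∃ y z, x = y ⊢ z` -/
def seq5 : LSeq.Sentence := ∀' ((&0 =' eT) ⊔ ∃' ∃' (&0 =' snocT &1 &2))

/-- `∀ x, x ∘ e = x ∧ e ∘ x = x` -/
def seqStar3 : LSeq.Sentence := ∀' ((catT &0 eT =' &0) ⊓ (catT eT &0 =' &0))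

/-- `∀ x y z w, x ∘ y = z ∘ w ↔ ∃ u, (z = x ∘ u ∧ u ∘ w = y) ∨ (x = z ∘ u ∧ u ∘ y = w)` -/
def seqStar5 : LSeq.Sentence :=
  ∀' ∀' ∀' ∀' ((catT &0 &1 =' catT &2 &3) ⇔
    ∃' (((&2 =' catT &0 &4) ⊓ (catT &4 &3 =' &1)) ⊔
        ((&0 =' catT &2 &4) ⊓ (catT &4 &1 =' &3))))

/-- `∀ x y z, x ∘ y = x ∘ z ∨ y ∘ x = z ∘ x → y = z` -/
def seqCancel : LSeq.Sentence :=
  ∀' ∀' ∀' (((catT &0 &1 =' catT &0 &2) ⊔ (catT &1 &0 =' catT &2 &0)) ⟹ (&1 =' &2))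

/-- The theory `Seq`. -/
def Seq : LSeq.Theory := {seq1, seq2, seq3, seq4, seq5}

/-- The theory `Seq⁺`. -/
def SeqPlus : LSeq.Theory := Seq ∪ {seqStar3, seqStar5, seqCancel}

/-! ### Classes and indexed sequences in a structure -/

section Structures

variable {M : Type} [LSeq.Structure M]

def empt : M := Structure.funMap (L := LSeq) SeqFunc.e ![]

def snoc (x y : M) : M := Structure.funMap (L := LSeq) SeqFunc.snoc ![x, y]

def cat (x y : M) : M := Structure.funMap (L := LSeq) SeqFunc.cat ![x, y]

local infixl:65 " ⊢ₛ " => snoc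
local infixl:70 " ∘ₛ " => cat

/-- The class (subset of the structure) defined by a formula with one free variable. -/
def classOf (M : Type) [LSeq.Structure M] (φ : LSeq.Formula (Fin 1)) : Set M :=
  {x | φ.Realize fun _ => x}

/-- `J` contains `e`, is closed under `⊢` and `∘`, and satisfies the axioms of `Seq*` (that is,
`Seq₁`, `Seq₂`, `Seq*₃`, `Seq₄`, `Seq*₅`); it contains every `e ⊢ w`; and the relation
`x ≼ y :↔ ∃ z ∈ J, y = x ∘ z` is reflexive and transitive, and `J` is downward closed under it. -/
structure IsStarClass (J : Set M) : Prop where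
  e_mem : empt ∈ J
  snoc_mem : ∀ x ∈ J, ∀ y ∈ J, x ⊢ₛ y ∈ J
  cat_mem : ∀ x ∈ J, ∀ y ∈ J, x ∘ₛ y ∈ J
  ax1 : ∀ x ∈ J, ∀ y ∈ J, x ⊢ₛ y ≠ empt
  ax2 : ∀ x₁ ∈ J, ∀ x₂ ∈ J, ∀ y₁ ∈ J, ∀ y₂ ∈ J, x₁ ⊢ₛ x₂ = y₁ ⊢ₛ y₂ → x₁ = y₁ ∧ x₂ = y₂
  ax3 : ∀ x ∈ J, x ∘ₛ empt = x ∧ empt ∘ₛ x = x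
  ax4 : ∀ x ∈ J, ∀ y ∈ J, ∀ z ∈ J, x ∘ₛ (y ⊢ₛ z) = (x ∘ₛ y) ⊢ₛ z
  ax5 : ∀ x ∈ J, ∀ y ∈ J, ∀ z ∈ J, ∀ w ∈ J, x ∘ₛ y = z ∘ₛ w ↔
    ∃ u ∈ J, (z = x ∘ₛ u ∧ u ∘ₛ w = y) ∨ (x = z ∘ₛ u ∧ u ∘ₛ y = w)
  singleton_mem : ∀ w : M, empt ⊢ₛ w ∈ J
  refl : ∀ x : M, ∃ z ∈ J, x = x ∘ₛ z
  trans : ∀ x y z : M, (∃ s ∈ J, y = x ∘ₛ s) → (∃ t ∈ J, z = y ∘ₛ t) → ∃ r ∈ J, z = x ∘ₛ r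
  down : ∀ y ∈ J, ∀ x : M, (∃ z ∈ J, y = x ∘ₛ z) → x ∈ J

/-- The successor of a number-like object; zero is `empt` and addition is `cat`. -/
def succ (x : M) : M := x ⊢ₛ empt

/-- `x ≤ y` relative to the class `N`. -/
def le (N : Set M) (x y : M) : Prop := ∃ z ∈ N, x ∘ₛ z = y

/-- `x < y` relative to the class `N`. -/
def lt (N : Set M) (x y : M) : Prop := le N x y ∧ x ≠ y

/-- `N` is a subclass of `J` containing `0` and closed under successor and addition, on which the
first five axioms of Robinson arithmetic hold, addition is associative, commutative and
cancellative, and `≤` is a linear order with least element `0`, that satisfies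
`x ≤ S y ↔ x = S y ∨ x ≤ y`; and `N` is downward closed under `≤`. -/
structure IsNumberClass (J N : Set M) : Prop where
  sub : N ⊆ J
  zero_mem : empt ∈ N
  succ_mem : ∀ x ∈ N, succ x ∈ N
  add_mem : ∀ x ∈ N, ∀ y ∈ N, x ∘ₛ y ∈ N
  succ_inj : ∀ x ∈ N, ∀ y ∈ N, succ x = succ y → x = y
  succ_ne_zero : ∀ x ∈ N, succ x ≠ empt
  exists_pred : ∀ x ∈ N, x ≠ empt → ∃ y ∈ N, x = succ y
  add_zero : ∀ x ∈ N, x ∘ₛ empt = x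
  add_succ : ∀ x ∈ N, ∀ y ∈ N, x ∘ₛ succ y = succ (x ∘ₛ y)
  add_assoc : ∀ x ∈ N, ∀ y ∈ N, ∀ z ∈ N, (x ∘ₛ y) ∘ₛ z = x ∘ₛ (y ∘ₛ z)
  add_comm : ∀ x ∈ N, ∀ y ∈ N, x ∘ₛ y = y ∘ₛ x
  add_cancel : ∀ x ∈ N, ∀ y ∈ N, ∀ z ∈ N, x ∘ₛ y = x ∘ₛ z → y = z
  le_refl : ∀ x ∈ N, le N x x
  le_trans : ∀ x ∈ N, ∀ y ∈ N, ∀ z ∈ N, le N x y → le N y z → le N x z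
  le_antisymm : ∀ x ∈ N, ∀ y ∈ N, le N x y → le N y x → x = y
  le_total : ∀ x ∈ N, ∀ y ∈ N, le N x y ∨ le N y x
  zero_le : ∀ x ∈ N, le N empt x
  le_succ : ∀ x ∈ N, ∀ y ∈ N, le N x (succ y) ↔ x = succ y ∨ le N x y
  down : ∀ x ∈ N, ∀ y : M, le N y x → y ∈ N

/-- `N'` is a subclass of `N` that contains `0`, is closed under successor and addition, and is
downward closed under `≤`. -/
structure IsSubdomain (N N' : Set M) : Prop where
  sub : N' ⊆ N
  zero_mem : empt ∈ N'
  succ_mem : ∀ x ∈ N', succ x ∈ N'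
  add_mem : ∀ x ∈ N', ∀ y ∈ N', x ∘ₛ y ∈ N'
  down : ∀ x ∈ N', ∀ y : M, le N y x → y ∈ N'

/-- `f(k) = u`: the pair `(k, u) := k ⊢ u`, with `u ∈ J`, is an entry of `f`. -/
def HasValue (J : Set M) (f k u : M) : Prop :=
  u ∈ J ∧ ∃ s ∈ J, ∃ t ∈ J, f = (s ⊢ₛ (k ⊢ₛ u)) ∘ₛ t

/-- `f : [m, n] → J` is an indexed sequence. -/
structure IsIndexed (J N : Set M) (f m n : M) : Prop where
  mem : f ∈ J
  left_mem : m ∈ N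
  right_mem : n ∈ N
  nonempty : le N m n
  /-- Every index has a value. -/
  total : ∀ k, le N m k → le N k n → ∃ u, HasValue J f k u
  /-- Every entry, whatever it is, is a pair of an index and an element of `J`. -/
  entries : ∀ s ∈ J, ∀ t ∈ J, ∀ w : M, f = (s ⊢ₛ w) ∘ₛ t →
    ∃ k u, le N m k ∧ le N k n ∧ u ∈ J ∧ w = k ⊢ₛ u
  /-- An entry that is not the first one comes right after an entry with the preceding index. -/
  consecutive : ∀ s ∈ J, ∀ t ∈ J, ∀ k ∈ J, ∀ u ∈ J, f = (s ⊢ₛ (k ⊢ₛ u)) ∘ₛ t → s ≠ empt →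
    lt N m k ∧ ∃ l ∈ J, ∃ v ∈ J, ∃ s₀ ∈ J, k = succ l ∧ s = s₀ ⊢ₛ (l ⊢ₛ v)
  /-- No entry before the one with index `k` has an index `k' ≥ k`. -/
  increasing : ∀ s ∈ J, ∀ t ∈ J, ∀ k ∈ J, ∀ u ∈ J, f = (s ⊢ₛ (k ⊢ₛ u)) ∘ₛ t →
    ¬ ∃ k' ∈ N, le N k k' ∧ ∃ u' ∈ J, ∃ s₀ ∈ J, ∃ t₀ ∈ J, s = (s₀ ⊢ₛ (k' ⊢ₛ u')) ∘ₛ t₀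

/-- The domain: `e` together with all indexed sequences `f : [0, n] → J` with `n ∈ N'`. -/
def InDomain (J N N' : Set M) (f : M) : Prop :=
  f = empt ∨ ∃ n ∈ N', IsIndexed J N f empt n

/-- `h = f ⌢ g`, for indexed sequences `f : [0, n] → J` and `g : [0, m] → J` with `n, m ∈ N'`:
`h : [0, n+m+1] → J` is `f ∘ g'`, where `g' : [n+1, n+1+m] → J` is `g` shifted by `n+1`, and
`h(j) = f(j)` for `j ≤ n` and `h(n+1+j) = g(j)` for `j ≤ m`. -/
def IsConcat (J N N' : Set M) (f g h : M) : Prop :=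
  ∃ n ∈ N', ∃ m ∈ N', IsIndexed J N f empt n ∧ IsIndexed J N g empt m ∧
    IsIndexed J N h empt (succ (n ∘ₛ m)) ∧
    (∃ g', IsIndexed J N g' (succ n) (succ n ∘ₛ m) ∧
      (∀ j, le N j m → ∀ u, HasValue J g' (succ n ∘ₛ j) u ↔ HasValue J g j u) ∧
      h = f ∘ₛ g') ∧
    (∀ j, le N j n → ∀ u, HasValue J h j u ↔ HasValue J f j u) ∧
    (∀ j, le N j m → ∀ u, HasValue J h (succ n ∘ₛ j) u ↔ HasValue J g j u)

/-- `h = f ⌢ g`, where `e` is by convention neutral for `⌢`. -/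
def IsConcatE (J N N' : Set M) (f g h : M) : Prop :=
  (f = empt ∧ h = g) ∨ (g = empt ∧ h = f) ∨ IsConcat J N N' f g h

/-- The indexed sequence `[0, 0] → J` with the only value `x`. -/
def single (x : M) : M := empt ⊢ₛ (empt ⊢ₛ x)

end Structures

end SeqInterp

open FirstOrder FirstOrder.Language

namespace SeqInterp

set_option linter.unusedSectionVars false

-- `Seq` has no induction, so properties are secured by shortening classes. One takes the definable
-- class of elements with a property, checks that it contains `e` and is closed under the relevant
-- `⊢ a`, and passes to its `core`. If the class consists of elements that associate, the core is
-- also closed under `∘` (`core_cat`) and downward closed (`core_down`). This is done three times.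
-- `starClass` gives associativity, left neutrality of `e` and the editor axiom. `numClass` gives
-- arithmetic; there `≤` is linear because the editor axiom can be applied to `x + y = y + x`.
-- `lenClass` gives the lengths for which sequences can be glued, shifted and split and are
-- determined by their values.
--
-- The star class satisfies the editor axiom but cancellation is not among its properties; indexing
-- the entries by numbers repairs this. A sequence indexed by `[0, n)` determines its length, is
-- determined by its values, and lengths add under concatenation. Associativity, cancellation and
-- the editor axiom for `⌢` thus reduce to arithmetic of lengths and comparison of values
-- (`isCat_assoc`, `isCat_cancel`, `isCat_editor`).
--
-- It remains to interpret `⊢`. Entries of sequences range over all of `J`, whereas the second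
-- argument of `⊢` ranges over the domain `D ⊆ J`. Axioms 2 and 5 ask that every `x ∈ J` be appended
-- by exactly one `g ∈ D`, that is, for a definable bijection from `J` onto `D`. `Code` is one in
-- the style of Hilbert's hotel: `x ∉ D` goes to the singleton with entry `(0, x)`, the singleton
-- with entry `(k, y)`, `y ∈ J \ D`, goes to the one with entry `(k+1, y)`, and the rest of `D` is
-- fixed. Storing the height `k` as a coordinate avoids iterating a map, which would need recursion.
--
-- All classes are defined by formulas that do not depend on the model, and a translated axiom holds
-- in `M` exactly when the axiom holds in the structure on the domain (`realize_translate`).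

local infixl:65 " ⊢ₛ " => snoc
local infixl:70 " ∘ₛ " => cat

/-! ### Semantics of translations -/

namespace Translation

variable {L L' : FirstOrder.Language.{0, 0}} (τ : Translation L L') {α : Type}
  {M : Type} [L'.Structure M]

/-- The domain of the translation in a structure. -/
def Dom (τ : Translation L L') (M : Type) [L'.Structure M] : Set M :=
  {x | τ.dom.Realize fun _ => x}

lemma realize_inDom (a : α) (v : α → M) : (τ.inDom a).Realize v ↔ v a ∈ τ.Dom M := by
  simp only [inDom, Formula.realize_relabel, Dom, Set.mem_ofPred_eq]
  exact Iff.rfl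

lemma realize_exDom (n : ℕ) (φ : L'.Formula (α ⊕ Fin n)) (v : α → M) :
    (τ.exDom n φ).Realize v ↔
      ∃ ys : Fin n → τ.Dom M, φ.Realize (Sum.elim v fun i => (ys i : M)) := by
  simp only [exDom, Formula.realize_iExs, Formula.realize_inf, Formula.realize_iInf,
    realize_inDom, Sum.elim_inr]
  constructor
  · rintro ⟨ys, h, hφ⟩
    exact ⟨fun i => ⟨ys i, h i⟩, hφ⟩
  · rintro ⟨ys, h⟩
    exact ⟨fun i => ys i, fun i => (ys i).2, h⟩

lemma realize_toBounded {n : ℕ} (φ : L'.Formula (α ⊕ Fin n)) (v : α → M) (xs : Fin n → M) :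
    (toBounded φ).Realize v xs ↔ φ.Realize (Sum.elim v xs) := by
  unfold toBounded
  refine (BoundedFormula.realize_relabel (n := 0)).trans ?_
  unfold Formula.Realize
  rw [Function.comp_id]
  exact iff_of_eq (congr_arg _ (Subsingleton.elim _ _))

variable [L.Structure (τ.Dom M)]

/-- By `hf` the formulas of `τ` define the graphs of the operations on the domain, so the
intermediate values quantified over in the unnesting are forced to be the values of the subterms. -/
lemma realize_termGraph
    (hf : ∀ (n : ℕ) (f : L.Functions n) (xs : Fin n → τ.Dom M) (y : τ.Dom M),
      (τ.fn f).Realize (Fin.cons (y : M) fun i => (xs i : M)) ↔ y = Structure.funMap f xs)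
    (t : L.Term α) (v : α → τ.Dom M) (y : τ.Dom M) :
    (τ.termGraph t).Realize (fun o : Option α => ((o.elim y v : τ.Dom M) : M)) ↔
      t.realize v = y := by
  induction t generalizing y with
  | var a => simp [termGraph, Subtype.ext_iff]
  | func f ts ih =>
    rename_i n
    simp only [termGraph, realize_exDom, Formula.realize_inf, Formula.realize_iInf,
      Formula.realize_relabel]
    have key : ∀ (ys : Fin n → τ.Dom M) (i : Fin n),
        (τ.termGraph (ts i)).Realize ((Sum.elim (fun o : Option α => ((o.elim y v : τ.Dom M) : M))
          fun i => (ys i : M)) ∘ fun o => o.elim (Sum.inr i) fun a => Sum.inl (some a)) ↔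
        (ts i).realize v = ys i := by
      intro ys i
      rw [← ih i]
      refine iff_of_eq (congr_arg _ ?_)
      funext o
      cases o <;> rfl
    have key2 : ∀ ys : Fin n → τ.Dom M,
        (τ.fn f).Realize ((Sum.elim (fun o : Option α => ((o.elim y v : τ.Dom M) : M))
          fun i => (ys i : M)) ∘ (Fin.cons (Sum.inl none) Sum.inr)) ↔
        y = Structure.funMap f ys := by
      intro ys
      rw [← hf]
      refine iff_of_eq (congr_arg _ ?_)
      funext i
      refine Fin.cases ?_ (fun i => ?_) i <;> simp
    simp only [key, key2, Term.realize_func]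
    constructor
    · rintro ⟨ys, h, rfl⟩
      exact congr_arg _ (funext h)
    · intro h
      exact ⟨_, fun i => rfl, h.symm⟩

lemma realize_atomic
    (hf : ∀ (n : ℕ) (f : L.Functions n) (xs : Fin n → τ.Dom M) (y : τ.Dom M),
      (τ.fn f).Realize (Fin.cons (y : M) fun i => (xs i : M)) ↔ y = Structure.funMap f xs)
    {n : ℕ} (ψ : L'.Formula (Fin n)) (ts : Fin n → L.Term α) (v : α → τ.Dom M) :
    (τ.atomic ψ ts).Realize (fun a => (v a : M)) ↔
      ψ.Realize fun i => (((ts i).realize v : τ.Dom M) : M) := by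
  simp only [atomic, realize_exDom, Formula.realize_inf, Formula.realize_iInf,
      Formula.realize_relabel]
  have key : ∀ (ys : Fin n → τ.Dom M) (i : Fin n),
      (τ.termGraph (ts i)).Realize ((Sum.elim (fun a => (v a : M))
        fun i => (ys i : M)) ∘ fun o => o.elim (Sum.inr i) Sum.inl) ↔
      (ts i).realize v = ys i := by
    intro ys i
    rw [← realize_termGraph τ hf]
    refine iff_of_eq (congr_arg _ ?_)
    funext o
    cases o <;> rfl
  simp only [key, Sum.elim_comp_inr]
  constructor
  · rintro ⟨ys, h, h'⟩
    simpa only [h] using h'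
  · intro h
    exact ⟨_, fun i => rfl, h⟩

/-- A translated formula holds iff the formula holds in the structure on the domain. -/
theorem realize_translate
    (hf : ∀ (n : ℕ) (f : L.Functions n) (xs : Fin n → τ.Dom M) (y : τ.Dom M),
      (τ.fn f).Realize (Fin.cons (y : M) fun i => (xs i : M)) ↔ y = Structure.funMap f xs)
    (hr : ∀ (n : ℕ) (R : L.Relations n) (xs : Fin n → τ.Dom M),
      (τ.rel R).Realize (fun i => (xs i : M)) ↔ Structure.RelMap R xs)
    {n : ℕ} (φ : L.BoundedFormula α n) (v : α → τ.Dom M) (xs : Fin n → τ.Dom M) :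
    (τ.translate φ).Realize (fun a => (v a : M)) (fun i => (xs i : M)) ↔ φ.Realize v xs := by
  have coe_elim : ∀ {n : ℕ} (xs : Fin n → τ.Dom M),
      Sum.elim (fun a => (v a : M)) (fun i => (xs i : M)) =
        fun a => ((Sum.elim v xs a : τ.Dom M) : M) := by
    intro n xs
    funext a
    cases a <;> rfl
  induction φ with
  | falsum => rfl
  | equal t₁ t₂ =>
    simp only [translate, realize_toBounded, coe_elim, realize_atomic τ hf,
      Formula.realize_equal, Term.realize_var, BoundedFormula.Realize]
    exact Subtype.ext_iff.symm
  | rel R ts =>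
    simp only [translate, realize_toBounded, coe_elim, realize_atomic τ hf, hr,
      BoundedFormula.Realize]
  | imp φ ψ ih₁ ih₂ => simp only [translate, BoundedFormula.realize_imp, ih₁, ih₂]
  | all φ ih =>
    simp only [translate, BoundedFormula.realize_all, BoundedFormula.realize_imp,
      realize_toBounded, realize_inDom, Sum.elim_inr, Fin.snoc_last]
    constructor
    · intro h x
      refine (ih _).1 ?_
      convert h x x.2 using 1
      funext i
      refine Fin.lastCases ?_ (fun i => ?_) i <;> simp
    · intro h x hx
      have := (ih _).2 (h ⟨x, hx⟩)
      convert this using 1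
      funext i
      refine Fin.lastCases ?_ (fun i => ?_) i <;> simp

end Translation

/-! ### Closure properties of uniform definability -/

/-- A property of tuples, given in all structures at once, that is defined by a formula. -/
def UDef {α : Type} (P : ∀ (M : Type) [LSeq.Structure M], (α → M) → Prop) : Prop :=
  ∃ φ : LSeq.Formula α, ∀ (M : Type) [LSeq.Structure M] (v : α → M), φ.Realize v ↔ P M v

/-- An operation on tuples, given in all structures at once, that is defined by a term. -/
def UTerm {α : Type} (f : ∀ (M : Type) [LSeq.Structure M], (α → M) → M) : Prop :=
  ∃ t : LSeq.Term α, ∀ (M : Type) [LSeq.Structure M] (v : α → M), t.realize v = f M v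

section Terms

variable {α M : Type} [LSeq.Structure M] (v : α → M) (s t : LSeq.Term α)

lemma realize_eT : (eT : LSeq.Term α).realize v = empt :=
  Term.realize_constants.trans (congr_arg (Structure.funMap (L := LSeq) SeqFunc.e)
    (Subsingleton.elim (α := Fin 0 → M) _ _))

lemma realize_snocT : (snocT s t).realize v = snoc (s.realize v) (t.realize v) :=
  Term.realize_functions_apply₂

lemma realize_catT : (catT s t).realize v = cat (s.realize v) (t.realize v) :=
  Term.realize_functions_apply₂

end Terms

section Definability

variable {α β : Type} {P Q : ∀ (M : Type) [LSeq.Structure M], (α → M) → Prop}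
  {f g : ∀ (M : Type) [LSeq.Structure M], (α → M) → M}

lemma UTerm.var (a : α) : UTerm (fun _ _ v => v a) :=
  ⟨Term.var a, fun _ _ _ => rfl⟩

lemma UTerm.weaken (hf : UTerm f) (e : α → β) : UTerm (fun M _ v => f M fun a => v (e a)) := by
  obtain ⟨t, ht⟩ := hf
  exact ⟨t.relabel e, fun M _ v => by rw [Term.realize_relabel, ht]; rfl⟩

lemma UTerm.empt : UTerm (α := α) (fun M _ _ => (SeqInterp.empt : M)) :=
  ⟨eT, fun _ _ v => realize_eT v⟩

lemma UTerm.snoc (hf : UTerm f) (hg : UTerm g) :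
    UTerm (fun M _ v => SeqInterp.snoc (f M v) (g M v)) := by
  obtain ⟨s, hs⟩ := hf
  obtain ⟨t, ht⟩ := hg
  exact ⟨snocT s t, fun M _ v => by rw [realize_snocT, hs, ht]⟩

lemma UTerm.cat (hf : UTerm f) (hg : UTerm g) :
    UTerm (fun M _ v => SeqInterp.cat (f M v) (g M v)) := by
  obtain ⟨s, hs⟩ := hf
  obtain ⟨t, ht⟩ := hg
  exact ⟨catT s t, fun M _ v => by rw [realize_catT, hs, ht]⟩

lemma UTerm.succ (hf : UTerm f) : UTerm (fun M _ v => SeqInterp.succ (f M v)) :=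
  hf.snoc .empt

lemma UTerm.single (hf : UTerm f) : UTerm (fun M _ v => SeqInterp.single (f M v)) :=
  UTerm.empt.snoc (UTerm.empt.snoc hf)

lemma UDef.congr (h : ∀ (M : Type) [LSeq.Structure M] (v : α → M), P M v ↔ Q M v)
    (hP : UDef P) : UDef Q := by
  obtain ⟨φ, hφ⟩ := hP
  exact ⟨φ, fun M _ v => (hφ M v).trans (h M v)⟩

lemma UDef.eq (hf : UTerm f) (hg : UTerm g) : UDef (fun M _ v => f M v = g M v) := by
  obtain ⟨s, hs⟩ := hf
  obtain ⟨t, ht⟩ := hg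
  exact ⟨s.equal t, fun M _ v => by rw [Formula.realize_equal, hs, ht]⟩

lemma UDef.not (hP : UDef P) : UDef (fun M _ v => ¬ P M v) := by
  obtain ⟨φ, hφ⟩ := hP
  exact ⟨φ.not, fun M _ v => by rw [Formula.realize_not, hφ]⟩

lemma UDef.imp (hP : UDef P) (hQ : UDef Q) : UDef (fun M _ v => P M v → Q M v) := by
  obtain ⟨φ, hφ⟩ := hP
  obtain ⟨ψ, hψ⟩ := hQ
  exact ⟨φ.imp ψ, fun M _ v => by rw [Formula.realize_imp, hφ, hψ]⟩

lemma UDef.and (hP : UDef P) (hQ : UDef Q) : UDef (fun M _ v => P M v ∧ Q M v) := by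
  obtain ⟨φ, hφ⟩ := hP
  obtain ⟨ψ, hψ⟩ := hQ
  exact ⟨φ ⊓ ψ, fun M _ v => by rw [Formula.realize_inf, hφ, hψ]⟩

lemma UDef.or (hP : UDef P) (hQ : UDef Q) : UDef (fun M _ v => P M v ∨ Q M v) := by
  obtain ⟨φ, hφ⟩ := hP
  obtain ⟨ψ, hψ⟩ := hQ
  exact ⟨φ ⊔ ψ, fun M _ v => by rw [Formula.realize_sup, hφ, hψ]⟩

lemma UDef.iff (hP : UDef P) (hQ : UDef Q) : UDef (fun M _ v => P M v ↔ Q M v) :=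
  ((hP.imp hQ).and (hQ.imp hP)).congr fun _ _ _ => iff_def.symm

lemma UDef.ex {R : ∀ (M : Type) [LSeq.Structure M], (α → M) → M → Prop}
    (hR : UDef (α := Option α) (fun M _ v => R M (fun a => v (some a)) (v none))) :
    UDef (fun M _ v => ∃ x, R M v x) := by
  obtain ⟨φ, hφ⟩ := hR
  refine ⟨Formula.iExs Unit (φ.relabel fun o => o.elim (Sum.inr ()) Sum.inl), fun M _ v => ?_⟩
  simp only [Formula.realize_iExs, Formula.realize_relabel, hφ]
  exact ⟨fun ⟨i, h⟩ => ⟨i (), h⟩, fun ⟨x, h⟩ => ⟨fun _ => x, h⟩⟩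

lemma UDef.all {R : ∀ (M : Type) [LSeq.Structure M], (α → M) → M → Prop}
    (hR : UDef (α := Option α) (fun M _ v => R M (fun a => v (some a)) (v none))) :
    UDef (fun M _ v => ∀ x, R M v x) :=
  (UDef.ex (R := fun M _ v x => ¬ R M v x) hR.not).not.congr fun M _ v => by simp

/-- Membership in a definable class. -/
lemma UDef.mem {C : ∀ (M : Type) [LSeq.Structure M], Set M}
    (hC : UDef (α := Fin 1) (fun M _ v => v 0 ∈ C M)) (hf : UTerm f) :
    UDef (fun M _ v => f M v ∈ C M) := by
  obtain ⟨φ, hφ⟩ := hC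
  obtain ⟨t, ht⟩ := hf
  refine ⟨φ.subst fun _ => t, fun M _ v => ?_⟩
  refine (BoundedFormula.realize_subst (v := v)).trans ?_
  change _ ↔ f M v ∈ C M
  rw [← ht]
  exact hφ M _

end Definability

/-! ### Shortening classes, the star class and the number class -/

/-- The axioms of `Seq`, for a structure. -/
class SeqModel (M : Type) [LSeq.Structure M] : Prop where
  snoc_ne : ∀ x y : M, x ⊢ₛ y ≠ empt
  snoc_inj : ∀ x₁ x₂ y₁ y₂ : M, x₁ ⊢ₛ x₂ = y₁ ⊢ₛ y₂ → x₁ = y₁ ∧ x₂ = y₂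
  cat_empt : ∀ x : M, x ∘ₛ empt = x
  cat_snoc : ∀ x y z : M, x ∘ₛ (y ⊢ₛ z) = (x ∘ₛ y) ⊢ₛ z
  cases : ∀ x : M, x = empt ∨ ∃ y z, x = y ⊢ₛ z

open SeqModel (snoc_ne snoc_inj cat_empt cat_snoc)

section Classes

variable (M : Type) [LSeq.Structure M]

/-- The elements that associate with everything on their left. -/
def assocClass : Set M := {t | ∀ x y, (x ∘ₛ y) ∘ₛ t = x ∘ₛ (y ∘ₛ t)}

variable {M}

/-- The elements of which all initial parts are in `W`. -/
def hered (W : Set M) : Set M := {x | ∀ y z, y ∘ₛ z = x → y ∈ W}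

/-- The largest part of `hered W` that preserves `hered W` under `∘`. -/
def core (W : Set M) : Set M := {x | x ∈ hered W ∧ ∀ y ∈ hered W, y ∘ₛ x ∈ hered W}

variable (M)

/-- The associating elements for which `e` is neutral on the left and the editor axiom holds. -/
def editorClass : Set M :=
  {w | w ∈ assocClass M ∧ empt ∘ₛ w = w ∧ ∀ x y z, x ∘ₛ y = z ∘ₛ w →
    ∃ u, (z = x ∘ₛ u ∧ u ∘ₛ w = y) ∨ (x = z ∘ₛ u ∧ u ∘ₛ y = w)}

/-- A class satisfying the axioms of `Seq*`. -/
def starClass : Set M := core (editorClass M)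

/-- Number-like elements, except that addition need not commute. -/
def preNumClass : Set M :=
  {x | x ∈ starClass M ∧ (empt ⊢ₛ empt) ∘ₛ x = succ x ∧ (x = empt ∨ ∃ y, x = succ y) ∧
    ∀ y z, y ∘ₛ x = z ∘ₛ x → y = z}

/-- Number-like elements whose addition commutes. -/
def commClass : Set M := {x | x ∈ preNumClass M ∧ ∀ y ∈ preNumClass M, x ∘ₛ y = y ∘ₛ x}

/-- A class of numbers. -/
def numClass : Set M := core (commClass M)

variable {M}

lemma hered_down {W : Set M} {x z : M} (hz : z ∈ assocClass M) (h : x ∘ₛ z ∈ hered W) :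
    x ∈ hered W := by
  rintro y w rfl
  exact h y (w ∘ₛ z) (hz y w).symm

/-- Only the removed factor `z` has to associate: then `y ∘ x` is an initial part of `y ∘ (x ∘ z)`.
-/
lemma core_down {W : Set M} {x z : M} (hz : z ∈ assocClass M) (h : x ∘ₛ z ∈ core W) :
    x ∈ core W :=
  ⟨hered_down hz h.1, fun y hy => by
    refine hered_down hz ?_
    rw [hz]
    exact h.2 y hy⟩

lemma editorClass_sub : editorClass M ⊆ assocClass M := fun _ h => h.1

end Classes

section Models

variable {M : Type} [LSeq.Structure M] [SeqModel M]

lemma cat_single (x w : M) : x ∘ₛ (empt ⊢ₛ w) = x ⊢ₛ w := by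
  rw [cat_snoc, cat_empt]

lemma cat_eq_empt {x y : M} (h : x ∘ₛ y = empt) : x = empt ∧ y = empt := by
  rcases SeqModel.cases y with rfl | ⟨a, b, rfl⟩
  · exact ⟨by rwa [cat_empt] at h, rfl⟩
  · rw [cat_snoc] at h
    exact absurd h (snoc_ne _ _)

lemma cat_eq_snoc {x y z w : M} (h : x ∘ₛ y = z ⊢ₛ w) :
    (y = empt ∧ x = z ⊢ₛ w) ∨ ∃ a, y = a ⊢ₛ w ∧ x ∘ₛ a = z := by
  rcases SeqModel.cases y with rfl | ⟨a, b, rfl⟩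
  · exact .inl ⟨rfl, by rwa [cat_empt] at h⟩
  · rw [cat_snoc] at h
    obtain ⟨rfl, rfl⟩ := snoc_inj _ _ _ _ h
    exact .inr ⟨a, rfl, rfl⟩

lemma hered_sub (W : Set M) : hered W ⊆ W := fun x hx => hx x empt (cat_empt x)

lemma hered_empt {W : Set M} (he : empt ∈ W) : empt ∈ hered W := by
  intro y z h
  rwa [(cat_eq_empt h).1]

lemma hered_snoc {W : Set M} {a : M} (ha : ∀ x ∈ W, x ⊢ₛ a ∈ W) {x : M} (hx : x ∈ hered W) :
    x ⊢ₛ a ∈ hered W := by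
  intro y z h
  rcases cat_eq_snoc h with ⟨-, rfl⟩ | ⟨b, -, rfl⟩
  · exact ha x (hered_sub W hx)
  · exact hx _ _ rfl

lemma core_sub (W : Set M) : core W ⊆ W := fun _ hx => hered_sub W hx.1

lemma core_empt {W : Set M} (he : empt ∈ W) : empt ∈ core W :=
  ⟨hered_empt he, fun y hy => by rwa [cat_empt]⟩

/-- With `a` fixed, this serves both closure under every `⊢ a` (star class) and closure under
successor, `a = e` (numbers and lengths). -/
lemma core_snoc {W : Set M} {a : M} (ha : ∀ x ∈ W, x ⊢ₛ a ∈ W) {x : M} (hx : x ∈ core W) :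
    x ⊢ₛ a ∈ core W :=
  ⟨hered_snoc ha hx.1, fun y hy => by
    rw [cat_snoc]
    exact hered_snoc ha (hx.2 y hy)⟩

/-- Associativity rewrites `z ∘ (x ∘ y)` as `(z ∘ x) ∘ y`, and `x` and `y` preserve `hered W` in
turn. -/
lemma core_cat {W : Set M} (hW : W ⊆ assocClass M) {x y : M} (hx : x ∈ core W)
    (hy : y ∈ core W) : x ∘ₛ y ∈ core W :=
  ⟨hy.2 x hx.1, fun z hz => by
    rw [← hW (core_sub W hy) z x]
    exact hy.2 _ (hx.2 z hz)⟩

lemma editorClass_empt : (empt : M) ∈ editorClass M := by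
  refine ⟨fun x y => by simp only [cat_empt], cat_empt _, fun x y z h => ⟨y, .inl ?_⟩⟩
  rw [cat_empt] at h
  exact ⟨h.symm, cat_empt y⟩

/-- For the editor property, split off the last entry of `y`. If `y = e`, all of `w ⊢ a` is the
overlap `u`; otherwise `y = b ⊢ a`, and the overlap for `x ∘ b = z ∘ w` still works. -/
lemma editorClass_snoc (a : M) {w : M} (hw : w ∈ editorClass M) : w ⊢ₛ a ∈ editorClass M := by
  obtain ⟨h₁, h₂, h₃⟩ := hw
  refine ⟨fun x y => by rw [cat_snoc, cat_snoc, cat_snoc, h₁], by rw [cat_snoc, h₂], ?_⟩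
  intro x y z h
  rw [cat_snoc] at h
  rcases cat_eq_snoc h with ⟨rfl, rfl⟩ | ⟨b, rfl, hb⟩
  · exact ⟨w ⊢ₛ a, .inr ⟨(cat_snoc _ _ _).symm, cat_empt _⟩⟩
  · obtain ⟨u, ⟨hz, rfl⟩ | ⟨hz, rfl⟩⟩ := h₃ x b z hb
    · exact ⟨u, .inl ⟨hz, cat_snoc _ _ _⟩⟩
    · exact ⟨u, .inr ⟨hz, cat_snoc _ _ _⟩⟩

lemma starClass_assoc {z : M} (hz : z ∈ starClass M) (x y : M) :
    (x ∘ₛ y) ∘ₛ z = x ∘ₛ (y ∘ₛ z) :=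
  (core_sub _ hz).1 x y

lemma starClass_snoc {x : M} (hx : x ∈ starClass M) (a : M) : x ⊢ₛ a ∈ starClass M :=
  core_snoc (fun _ => editorClass_snoc a) hx

lemma starClass_down {x z : M} (hz : z ∈ starClass M) (h : x ∘ₛ z ∈ starClass M) :
    x ∈ starClass M :=
  core_down (core_sub _ hz).1 h

variable (M) in
theorem isStarClass_starClass : IsStarClass (starClass M) where
  e_mem := core_empt editorClass_empt
  snoc_mem x hx y _ := starClass_snoc hx y
  cat_mem x hx y hy := core_cat editorClass_sub hx hy
  ax1 x _ y _ := snoc_ne x y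
  ax2 x₁ _ x₂ _ y₁ _ y₂ _ := snoc_inj x₁ x₂ y₁ y₂
  ax3 x hx := ⟨cat_empt x, (core_sub _ hx).2.1⟩
  ax4 x _ y _ z _ := cat_snoc x y z
  ax5 x hx y hy z hz w hw := by
    constructor
    · intro h
      obtain ⟨u, hu⟩ := (core_sub _ hw).2.2 x y z h
      refine ⟨u, ?_, hu⟩
      -- The editor class yields `u` only in `M`, but `u` is an initial part of `y` or of `w`.
      rcases hu with ⟨-, rfl⟩ | ⟨-, rfl⟩
      · exact starClass_down hw hy
      · exact starClass_down hy hw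
    · rintro ⟨u, hu, ⟨rfl, rfl⟩ | ⟨rfl, rfl⟩⟩
      · exact (starClass_assoc hw x u).symm
      · exact starClass_assoc hy z u
  singleton_mem w := starClass_snoc (core_empt editorClass_empt) w
  refl x := ⟨empt, core_empt editorClass_empt, (cat_empt x).symm⟩
  trans := by
    rintro x _ _ ⟨s, hs, rfl⟩ ⟨t, ht, rfl⟩
    exact ⟨s ∘ₛ t, core_cat editorClass_sub hs ht, starClass_assoc ht x s⟩
  down := by
    rintro _ hy x ⟨z, hz, rfl⟩
    exact starClass_down hz hy

lemma preNumClass_empt : (empt : M) ∈ preNumClass M :=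
  ⟨core_empt editorClass_empt, cat_empt _, .inl rfl, fun y z h => by simpa only [cat_empt] using h⟩

lemma preNumClass_succ {x : M} (hx : x ∈ preNumClass M) : succ x ∈ preNumClass M := by
  obtain ⟨h₁, h₂, -, h₃⟩ := hx
  refine ⟨starClass_snoc h₁ _, ?_, .inr ⟨x, rfl⟩, fun y z h => ?_⟩
  · unfold succ at *
    rw [cat_snoc, h₂]
  · unfold succ at h
    rw [cat_snoc, cat_snoc] at h
    exact h₃ y z (snoc_inj _ _ _ _ h).1

lemma commClass_empt : (empt : M) ∈ commClass M :=
  ⟨preNumClass_empt, fun y hy => by rw [cat_empt, (core_sub _ hy.1).2.1]⟩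

/-- The condition `1 + y = S y` on pre-numbers takes the place of an induction on `y`. -/
lemma commClass_succ {x : M} (hx : x ∈ commClass M) : succ x ∈ commClass M := by
  refine ⟨preNumClass_succ hx.1, fun y hy => ?_⟩
  calc succ x ∘ₛ y = (x ∘ₛ (empt ⊢ₛ empt)) ∘ₛ y := by rw [cat_single, succ]
    _ = x ∘ₛ succ y := by rw [starClass_assoc hy.1, hy.2.1]
    _ = succ (y ∘ₛ x) := by rw [succ, cat_snoc, hx.2 y hy, succ]
    _ = y ∘ₛ succ x := (cat_snoc _ _ _).symm

lemma commClass_sub : commClass M ⊆ assocClass M := fun _ h => (core_sub _ h.1.1).1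

lemma numClass_down {x z : M} (hz : z ∈ starClass M) (h : x ∘ₛ z ∈ numClass M) :
    x ∈ numClass M :=
  core_down (core_sub _ hz).1 h

variable (M) in
theorem isNumberClass_numClass : IsNumberClass (starClass M) (numClass M) := by
  have sub : numClass M ⊆ starClass M := fun x hx => (core_sub _ hx).1.1
  have comm : ∀ x ∈ numClass M, ∀ y ∈ numClass M, x ∘ₛ y = y ∘ₛ x :=
    fun x hx y hy => (core_sub _ hx).2 y (core_sub _ hy).1
  have zero : (empt : M) ∈ numClass M := core_empt commClass_empt
  have succ_mem : ∀ x ∈ numClass M, succ x ∈ numClass M :=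
    fun x hx => core_snoc (fun _ => commClass_succ) hx
  have add_mem : ∀ x ∈ numClass M, ∀ y ∈ numClass M, x ∘ₛ y ∈ numClass M :=
    fun x hx y hy => core_cat commClass_sub hx hy
  have exists_pred : ∀ x ∈ numClass M, x ≠ empt → ∃ y ∈ numClass M, x = succ y := by
    intro x hx h
    obtain ⟨y, rfl⟩ := (core_sub _ hx).1.2.2.1.resolve_left h
    refine ⟨y, numClass_down (z := empt ⊢ₛ empt) ?_ ?_, rfl⟩
    · exact (isStarClass_starClass M).singleton_mem _
    · rwa [cat_single]
  have refl : ∀ x ∈ numClass M, le (numClass M) x x := fun x _ => ⟨empt, zero, cat_empt x⟩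
  refine
  { sub := sub
    zero_mem := zero
    succ_mem := succ_mem
    add_mem := add_mem
    succ_inj := fun x _ y _ h => (snoc_inj _ _ _ _ h).1
    succ_ne_zero := fun x _ => snoc_ne _ _
    exists_pred := exists_pred
    add_zero := fun x _ => cat_empt x
    add_succ := fun x _ y _ => cat_snoc _ _ _
    add_assoc := fun x _ y _ z hz => starClass_assoc (sub hz) x y
    add_comm := comm
    add_cancel := ?_
    le_refl := refl
    le_trans := ?_
    le_antisymm := ?_
    le_total := ?_
    zero_le := fun x hx => ⟨x, hx, (core_sub _ (sub hx)).2.1⟩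
    le_succ := ?_
    down := ?_ }
  · intro x hx y hy z hz h
    rw [comm x hx y hy, comm x hx z hz] at h
    exact (core_sub _ hx).1.2.2.2 y z h
  · rintro x hx _ - _ - ⟨s, hs, rfl⟩ ⟨t, ht, rfl⟩
    exact ⟨s ∘ₛ t, add_mem s hs t ht, (starClass_assoc (sub ht) x s).symm⟩
  · rintro x hx _ - ⟨s, hs, rfl⟩ ⟨t, ht, h⟩
    have hst := add_mem s hs t ht
    -- From `x + s + t = x`, commuting and cancelling `x` gives `s + t = 0`, hence `s = 0`.
    have : (s ∘ₛ t) ∘ₛ x = empt ∘ₛ x := by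
      rw [← comm x hx _ hst, ← starClass_assoc (sub ht), h, (core_sub _ (sub hx)).2.1]
    rw [(cat_eq_empt ((core_sub _ hx).1.2.2.2 _ _ this)).1, cat_empt]
  · intro x hx y hy
    -- Linearity: the editor axiom for `x + y = y + x` yields `u` with `y = x + u` or `x = y + u`;
    -- moreover `u` is an initial part of the larger number, hence a number.
    obtain ⟨u, hu, ⟨h, h'⟩ | ⟨h, h'⟩⟩ := ((isStarClass_starClass M).ax5 x (sub hx) y (sub hy) y
      (sub hy) x (sub hx)).1 (comm x hx y hy)
    · exact .inl ⟨u, numClass_down (sub hx) (by rwa [h']), h.symm⟩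
    · exact .inr ⟨u, numClass_down (sub hy) (by rwa [h']), h.symm⟩
  · intro x hx y hy
    constructor
    · rintro ⟨z, hz, h⟩
      rcases cat_eq_snoc h with ⟨-, h'⟩ | ⟨a, rfl, h'⟩
      · exact .inl h'
      · refine .inr ⟨a, numClass_down (z := empt ⊢ₛ empt) ?_ ?_, h'⟩
        · exact (isStarClass_starClass M).singleton_mem _
        · rwa [cat_single]
    · rintro (rfl | ⟨z, hz, rfl⟩)
      · exact refl _ hx
      · exact ⟨succ z, succ_mem z hz, cat_snoc _ _ _⟩
  · rintro x hx y ⟨z, hz, rfl⟩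
    exact numClass_down (sub hz) hx

end Models

/-! ### Indexed sequences: removing and appending the last entry -/

section Segments

variable {M : Type} [LSeq.Structure M]

/-- A star class together with a number class in it. -/
structure Setting (J N : Set M) : Prop where
  star : IsStarClass J
  num : IsNumberClass J N

variable {J N : Set M}

variable [SeqModel M]

lemma snoc_eq_cat_iff {s w s' w' t : M} :
    s ⊢ₛ w = (s' ⊢ₛ w') ∘ₛ t ↔
      (t = empt ∧ s = s' ∧ w = w') ∨ ∃ t', t = t' ⊢ₛ w ∧ s = (s' ⊢ₛ w') ∘ₛ t' := by
  constructor
  · intro h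
    rcases cat_eq_snoc h.symm with ⟨rfl, h'⟩ | ⟨a, rfl, h'⟩
    · obtain ⟨rfl, rfl⟩ := snoc_inj _ _ _ _ h'
      exact .inl ⟨rfl, rfl, rfl⟩
    · exact .inr ⟨a, rfl, h'.symm⟩
  · rintro (⟨rfl, rfl, rfl⟩ | ⟨t', rfl, rfl⟩)
    · exact (cat_empt _).symm
    · exact (cat_snoc _ _ _).symm

lemma not_hasValue_empt {k u : M} : ¬ HasValue J empt k u := by
  rintro ⟨-, s, -, t, -, h⟩
  exact snoc_ne _ _ (cat_eq_empt h.symm).1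

namespace Setting

variable (H : Setting J N)
include H
variable {f g s t u v w x y z a b c j k n m : M}

/-- `x ⊢ w` is `x ∘ (e ⊢ w)`, and `e ⊢ w` is in `J` even when `w` is not. -/
lemma snoc_mem (hx : x ∈ J) (w : M) : x ⊢ₛ w ∈ J := by
  rw [← cat_single]
  exact H.star.cat_mem _ hx _ (H.star.singleton_mem w)

lemma of_snoc_mem (h : x ⊢ₛ w ∈ J) : x ∈ J :=
  H.star.down _ h x ⟨_, H.star.singleton_mem w, (cat_single _ _).symm⟩

lemma empt_cat (hx : x ∈ J) : empt ∘ₛ x = x := (H.star.ax3 x hx).2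

/-- The right-to-left direction of the editor axiom with overlap `u = y`. -/
lemma assoc (hx : x ∈ J) (hy : y ∈ J) (hz : z ∈ J) : (x ∘ₛ y) ∘ₛ z = x ∘ₛ (y ∘ₛ z) :=
  ((H.star.ax5 x hx _ (H.star.cat_mem _ hy _ hz) _ (H.star.cat_mem _ hx _ hy) z hz).2
    ⟨y, hy, .inl ⟨rfl, rfl⟩⟩).symm

lemma mem_of_succ_mem (hx : succ x ∈ N) : x ∈ N :=
  H.num.down _ hx x ⟨succ empt, H.num.succ_mem _ H.num.zero_mem, cat_single _ _⟩

lemma le_succ_self (hx : x ∈ N) : le N x (succ x) :=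
  (H.num.le_succ x hx x hx).2 (.inr (H.num.le_refl x hx))

lemma not_succ_le (hx : x ∈ N) : ¬ le N (succ x) x := by
  intro h
  have h' := H.num.le_antisymm _ hx _ (H.num.succ_mem x hx) (H.le_succ_self hx) h
  have : x ∘ₛ succ empt = x ∘ₛ empt := by rw [cat_empt, succ, cat_single]; exact h'.symm
  exact snoc_ne _ _ (H.num.add_cancel x hx _ (H.num.succ_mem _ H.num.zero_mem) _ H.num.zero_mem this)

lemma le_right_mem (hx : x ∈ N) (h : le N x y) : y ∈ N := by
  obtain ⟨z, hz, rfl⟩ := h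
  exact H.num.add_mem x hx z hz

lemma succ_le_succ (hx : x ∈ N) (hy : y ∈ N) (h : le N x y) : le N (succ x) (succ y) := by
  obtain ⟨z, hz, rfl⟩ := h
  refine ⟨z, hz, ?_⟩
  rw [H.num.add_comm _ (H.num.succ_mem x hx) z hz, H.num.add_succ z hz x hx,
    H.num.add_comm x hx z hz]

lemma hasValue_snoc (hs : s ∈ J) :
    HasValue J (s ⊢ₛ w) k v ↔ (w = k ⊢ₛ v ∧ v ∈ J) ∨ HasValue J s k v := by
  constructor
  · rintro ⟨hv, s', hs', t, ht, h⟩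
    rcases snoc_eq_cat_iff.1 h with ⟨rfl, rfl, rfl⟩ | ⟨t', rfl, rfl⟩
    · exact .inl ⟨rfl, hv⟩
    · exact .inr ⟨hv, s', hs', t', H.of_snoc_mem ht, rfl⟩
  · rintro (⟨rfl, hv⟩ | ⟨hv, s', hs', t', ht', rfl⟩)
    · exact ⟨hv, s, hs, empt, H.star.e_mem, (cat_empt _).symm⟩
    · exact ⟨hv, s', hs', t' ⊢ₛ w, H.snoc_mem ht' w, (cat_snoc _ _ _).symm⟩

/-- The editor axiom compares the cut just after the entry with the cut between `f` and `g`; an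
entry cannot straddle the latter. -/
lemma hasValue_cat (hf : f ∈ J) (hg : g ∈ J) :
    HasValue J (f ∘ₛ g) k v ↔ HasValue J f k v ∨ HasValue J g k v := by
  constructor
  · rintro ⟨hv, s, hs, t, ht, h⟩
    obtain ⟨x, hx, ⟨h₁, h₂⟩ | ⟨h₁, h₂⟩⟩ := (H.star.ax5 f hf g hg _ (H.snoc_mem hs _) t ht).1 h
    · rcases cat_eq_snoc h₁.symm with ⟨rfl, rfl⟩ | ⟨x', rfl, -⟩
      · exact .inl ⟨hv, s, hs, empt, H.star.e_mem, (cat_empt _).symm⟩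
      · exact .inr ⟨hv, x', H.of_snoc_mem hx, t, ht, h₂.symm⟩
    · exact .inl ⟨hv, s, hs, x, hx, h₁⟩
  · rintro (⟨hv, s, hs, t, ht, rfl⟩ | ⟨hv, s, hs, t, ht, rfl⟩)
    · exact ⟨hv, s, hs, t ∘ₛ g, H.star.cat_mem _ ht _ hg, H.assoc (H.snoc_mem hs _) ht hg⟩
    · refine ⟨hv, f ∘ₛ s, H.star.cat_mem _ hf _ hs, t, ht, ?_⟩
      rw [← H.assoc hf (H.snoc_mem hs _) ht, cat_snoc]

lemma index_range (hf : IsIndexed J N f m n) (h : HasValue J f k v) : le N m k ∧ le N k n := by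
  obtain ⟨hv, s, hs, t, ht, h⟩ := h
  obtain ⟨k', u, h₁, h₂, -, h₃⟩ := hf.entries s hs t ht _ h
  obtain ⟨rfl, rfl⟩ := snoc_inj _ _ _ _ h₃
  exact ⟨h₁, h₂⟩

/-- The last entry of an indexed sequence. -/
lemma exists_last (hf : IsIndexed J N f m n) :
    ∃ s ∈ J, ∃ u ∈ J, f = s ⊢ₛ (n ⊢ₛ u) := by
  obtain ⟨v, hv, s', hs', t, ht, h⟩ := hf.total n hf.nonempty (H.num.le_refl n hf.right_mem)
  -- If something followed the entry with index `n`, the last entry would have an index `k ≤ n`, and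
  -- `increasing` forbids that after `n`.
  rcases SeqModel.cases t with rfl | ⟨t', w, rfl⟩
  · exact ⟨s', hs', v, hv, by rw [h, cat_empt]⟩
  · rw [cat_snoc] at h
    have ht' := H.of_snoc_mem ht
    have hs := H.star.cat_mem _ (H.snoc_mem hs' (n ⊢ₛ v)) _ ht'
    have h' := h.trans (cat_empt _).symm
    obtain ⟨k, u, h₁, h₂, hu, rfl⟩ := hf.entries _ hs empt H.star.e_mem w h'
    have hk := H.le_right_mem hf.left_mem h₁
    exact absurd ⟨n, hf.right_mem, h₂, v, hv, s', hs', t', ht', rfl⟩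
      (hf.increasing _ hs empt H.star.e_mem k (H.num.sub hk) u hu h')

/-- An indexed sequence is a one-element sequence or arises from a shorter one by `⊢`. -/
lemma exists_init (hf : IsIndexed J N f m n) :
    ∃ s ∈ J, ∃ u ∈ J, f = s ⊢ₛ (n ⊢ₛ u) ∧
      ((m = n ∧ s = empt) ∨ ∃ l ∈ N, n = succ l ∧ IsIndexed J N s m l) := by
  obtain ⟨s, hs, u, hu, rfl⟩ := H.exists_last hf
  have he := H.star.e_mem
  refine ⟨s, hs, u, hu, rfl, ?_⟩
  by_cases hse : s = empt
  · refine .inl ⟨?_, hse⟩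
    subst hse
    obtain ⟨v, hv⟩ := hf.total m (H.num.le_refl m hf.left_mem) hf.nonempty
    rcases (H.hasValue_snoc he).1 hv with h | h
    · exact (snoc_inj _ _ _ _ h.1).1.symm
    · exact absurd h not_hasValue_empt
  · have hcons := hf.consecutive s hs empt he n (H.num.sub hf.right_mem) u hu (cat_empt _).symm hse
    have hinc := hf.increasing s hs empt he n (H.num.sub hf.right_mem) u hu (cat_empt _).symm
    obtain ⟨hlt, l, -, v, hv, s₀, hs₀, rfl, rfl⟩ := hcons
    have hl := H.mem_of_succ_mem hf.right_mem
    refine .inr ⟨l, hl, rfl, ?_⟩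
    -- A cut of the initial part becomes a cut of the whole when the last entry is added to the
    -- right factor, so `consecutive` and `increasing` are inherited.
    have up : ∀ {s' w t}, s₀ ⊢ₛ (l ⊢ₛ v) = (s' ⊢ₛ w) ∘ₛ t →
        (s₀ ⊢ₛ (l ⊢ₛ v)) ⊢ₛ (succ l ⊢ₛ u) = (s' ⊢ₛ w) ∘ₛ (t ⊢ₛ (succ l ⊢ₛ u)) := by
      intro s' w t h
      rw [h, cat_snoc]
    refine
    { mem := hs
      left_mem := hf.left_mem
      right_mem := hl
      nonempty := ((H.num.le_succ m hf.left_mem l hl).1 hlt.1).resolve_left hlt.2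
      total := ?_
      entries := ?_
      consecutive := fun s' hs' t ht k hk u' hu' h =>
        hf.consecutive s' hs' _ (H.snoc_mem ht _) k hk u' hu' (up h)
      increasing := fun s' hs' t ht k hk u' hu' h =>
        hf.increasing s' hs' _ (H.snoc_mem ht _) k hk u' hu' (up h) }
    · intro k hmk hkl
      have hk := H.le_right_mem hf.left_mem hmk
      obtain ⟨v', hv'⟩ := hf.total k hmk ((H.num.le_succ k hk l hl).2 (.inr hkl))
      rcases (H.hasValue_snoc hs).1 hv' with h | h
      · rw [← (snoc_inj _ _ _ _ h.1).1] at hkl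
        exact absurd hkl (H.not_succ_le hl)
      · exact ⟨v', h⟩
    · intro s' hs' t ht w h
      obtain ⟨k, u', h₁, h₂, hu', rfl⟩ := hf.entries s' hs' _ (H.snoc_mem ht _) w (up h)
      refine ⟨k, u', h₁, ?_, hu', rfl⟩
      -- An earlier entry with index `succ l` would contradict `increasing` at the last entry.
      rcases (H.num.le_succ k (H.le_right_mem hf.left_mem h₁) l hl).1 h₂ with rfl | h₂
      · exact absurd ⟨succ l, hf.right_mem, H.num.le_refl _ hf.right_mem, u', hu', s', hs', t, ht, h⟩
          hinc
      · exact h₂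

lemma isIndexed_singleton (hn : n ∈ N) (hu : u ∈ J) :
    IsIndexed J N (empt ⊢ₛ (n ⊢ₛ u)) n n := by
  have key : ∀ {s t w : M}, empt ⊢ₛ (n ⊢ₛ u) = (s ⊢ₛ w) ∘ₛ t → s = empt ∧ w = n ⊢ₛ u := by
    intro s t w h
    rcases snoc_eq_cat_iff.1 h with ⟨-, rfl, rfl⟩ | ⟨t', -, h⟩
    · exact ⟨rfl, rfl⟩
    · exact absurd (cat_eq_empt h.symm).1 (snoc_ne _ _)
  have hnn := H.num.le_refl n hn
  refine
  { mem := H.star.singleton_mem _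
    left_mem := hn
    right_mem := hn
    nonempty := hnn
    total := ?_
    entries := ?_
    consecutive := fun s _ t _ k _ v _ h hs => absurd (key h).1 hs
    increasing := ?_ }
  · intro k h₁ h₂
    obtain rfl := H.num.le_antisymm n hn k (H.le_right_mem hn h₁) h₁ h₂
    exact ⟨u, (H.hasValue_snoc H.star.e_mem).2 (.inl ⟨rfl, hu⟩)⟩
  · intro s _ t _ w h
    exact ⟨n, u, hnn, hnn, hu, (key h).2⟩
  · rintro s - t - k - v - h ⟨k', -, -, u', -, s₀, -, t₀, -, h'⟩
    rw [(key h).1] at h'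
    exact snoc_ne _ _ (cat_eq_empt h'.symm).1

/-- Converse of `exists_init`; together they give the recursive description of indexed sequences on
which the arguments about lengths rest. -/
lemma isIndexed_snoc (hs : IsIndexed J N s m n) (hu : u ∈ J) :
    IsIndexed J N (s ⊢ₛ (succ n ⊢ₛ u)) m (succ n) := by
  have hn := hs.right_mem
  have hm := hs.left_mem
  have hSn := H.num.succ_mem n hn
  have hmn : le N m (succ n) := (H.num.le_succ m hm n hn).2 (.inr hs.nonempty)
  refine
  { mem := H.snoc_mem hs.mem _
    left_mem := hm
    right_mem := hSn
    nonempty := hmn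
    total := ?_
    entries := ?_
    consecutive := ?_
    increasing := ?_ }
  · intro k h₁ h₂
    rcases (H.num.le_succ k (H.le_right_mem hm h₁) n hn).1 h₂ with rfl | h₂
    · exact ⟨u, (H.hasValue_snoc hs.mem).2 (.inl ⟨rfl, hu⟩)⟩
    · obtain ⟨v, hv⟩ := hs.total k h₁ h₂
      exact ⟨v, (H.hasValue_snoc hs.mem).2 (.inr hv)⟩
  · intro s' hs' t ht w h
    rcases snoc_eq_cat_iff.1 h with ⟨-, -, rfl⟩ | ⟨t', rfl, h'⟩
    · exact ⟨_, u, hmn, H.num.le_refl _ hSn, hu, rfl⟩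
    · obtain ⟨k, u', h₁, h₂, hu', rfl⟩ := hs.entries s' hs' t' (H.of_snoc_mem ht) w h'
      exact ⟨k, u', h₁, (H.num.le_succ k (H.le_right_mem hm h₁) n hn).2 (.inr h₂), hu', rfl⟩
  · intro s' hs' t ht k hk u' hu' h hne
    rcases snoc_eq_cat_iff.1 h with ⟨-, rfl, h'⟩ | ⟨t', rfl, h'⟩
    · obtain ⟨rfl, -⟩ := snoc_inj _ _ _ _ h'
      obtain ⟨s₀, hs₀, v, hv, rfl⟩ := H.exists_last hs
      refine ⟨⟨hmn, ?_⟩, n, H.num.sub hn, v, hv, s₀, hs₀, rfl, rfl⟩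
      intro h
      exact H.not_succ_le hn (h ▸ hs.nonempty)
    · exact hs.consecutive s' hs' t' (H.of_snoc_mem ht) k hk u' hu' h' hne
  · intro s' hs' t ht k hk u' hu' h
    rcases snoc_eq_cat_iff.1 h with ⟨-, rfl, h'⟩ | ⟨t', rfl, h'⟩
    · obtain ⟨rfl, -⟩ := snoc_inj _ _ _ _ h'
      rintro ⟨k', hk', hle, v, -, s₀, hs₀, t₀, ht₀, h''⟩
      obtain ⟨k'', v', -, h₂, -, h₃⟩ := hs.entries s₀ hs₀ t₀ ht₀ _ h''
      obtain ⟨rfl, -⟩ := snoc_inj _ _ _ _ h₃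
      exact H.not_succ_le hn (H.num.le_trans _ hSn _ hk' _ hn hle h₂)
    · exact hs.increasing s' hs' t' (H.of_snoc_mem ht) k hk u' hu' h'

end Setting

end Segments

/-! ### Half-open segments and the class of good lengths -/

section Lengths

variable {M : Type} [LSeq.Structure M]

/-- `f` is a possibly empty sequence indexed by the half-open interval `[a, b)`. -/
def Seg (J N : Set M) (f a b : M) : Prop :=
  (a ∈ N ∧ b = a ∧ f = empt) ∨ ∃ n, b = succ n ∧ IsIndexed J N f a n

/-- `g'` is the shift of `g` by `n`: its value at `n + j` is that of `g` at `j`. -/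
def IsShift (J N : Set M) (n g g' : M) : Prop :=
  ∀ j ∈ N, ∀ u, HasValue J g' (n ∘ₛ j) u ↔ HasValue J g j u

/-- Segments that end at `c`, or that have length `c`, behave as expected. -/
structure SegGood (J N : Set M) (c : M) : Prop where
  cat : ∀ a b f g, Seg J N f a b → Seg J N g b c → Seg J N (f ∘ₛ g) a c
  ext : ∀ a f g, Seg J N f a c → Seg J N g a c →
    (∀ j u, HasValue J f j u ↔ HasValue J g j u) → f = g
  shift : ∀ n ∈ N, ∀ g, Seg J N g empt c → ∃ g', Seg J N g' n (n ∘ₛ c) ∧ IsShift J N n g g'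
  split : ∀ a b g, Seg J N g a c → le N a b → le N b c →
    ∃ u v, g = u ∘ₛ v ∧ Seg J N u a b ∧ Seg J N v b c
  unshift : ∀ n ∈ N, ∀ g', Seg J N g' n (n ∘ₛ c) → ∃ g, Seg J N g empt c ∧ IsShift J N n g g'

/-- The numbers `c` such that all segments that end at `c`, or that have length `c`, behave as
expected. -/
def segClass (J N : Set M) : Set M := {c | c ∈ N ∧ SegGood J N c}

/-- The class of lengths. -/
def lenClass (J N : Set M) : Set M := core (segClass J N)

variable {J N : Set M} [SeqModel M]

namespace Setting

variable (H : Setting J N)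
variable {f g s t u v w x y z a b c j k n m : M}
include H

lemma seg_mem (hf : Seg J N f a b) : f ∈ J := by
  rcases hf with ⟨-, -, rfl⟩ | ⟨n, -, h⟩
  · exact H.star.e_mem
  · exact h.mem

lemma seg_left_mem (hf : Seg J N f a b) : a ∈ N := by
  rcases hf with ⟨h, -⟩ | ⟨n, -, h⟩
  · exact h
  · exact h.left_mem

lemma seg_le (hf : Seg J N f a b) : le N a b := by
  rcases hf with ⟨h, rfl, -⟩ | ⟨n, rfl, h⟩
  · exact H.num.le_refl _ h
  · exact (H.num.le_succ a h.left_mem n h.right_mem).2 (.inr h.nonempty)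

lemma seg_right_mem (hf : Seg J N f a b) : b ∈ N :=
  H.le_right_mem (H.seg_left_mem hf) (H.seg_le hf)

lemma seg_range (hf : Seg J N f a b) (h : HasValue J f k v) :
    k ∈ N ∧ le N a k ∧ le N (succ k) b := by
  rcases hf with ⟨-, -, rfl⟩ | ⟨n, rfl, hn⟩
  · exact absurd h not_hasValue_empt
  · obtain ⟨h₁, h₂⟩ := H.index_range hn h
    have hk := H.le_right_mem hn.left_mem h₁
    exact ⟨hk, h₁, H.succ_le_succ hk hn.right_mem h₂⟩

lemma seg_empt (ha : a ∈ N) : Seg J N empt a a := .inl ⟨ha, rfl, rfl⟩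

lemma seg_snoc (hs : Seg J N s a c) (hu : u ∈ J) : Seg J N (s ⊢ₛ (c ⊢ₛ u)) a (succ c) := by
  rcases hs with ⟨ha, rfl, rfl⟩ | ⟨n, rfl, h⟩
  · exact .inr ⟨c, rfl, H.isIndexed_singleton ha hu⟩
  · exact .inr ⟨_, rfl, H.isIndexed_snoc h hu⟩

/-- Half-open intervals unify the two cases of `exists_init`: removing the entry of a singleton
leaves the empty segment. -/
lemma seg_cases (hf : Seg J N f a b) :
    (b = a ∧ f = empt) ∨
      ∃ c s u, b = succ c ∧ u ∈ J ∧ f = s ⊢ₛ (c ⊢ₛ u) ∧ Seg J N s a c := by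
  rcases hf with ⟨-, rfl, rfl⟩ | ⟨n, rfl, h⟩
  · exact .inl ⟨rfl, rfl⟩
  · obtain ⟨s, hs, u, hu, rfl, ⟨rfl, rfl⟩ | ⟨l, hl, rfl, h'⟩⟩ := H.exists_init h
    · exact .inr ⟨_, _, u, rfl, hu, rfl, H.seg_empt h.left_mem⟩
    · exact .inr ⟨_, _, u, rfl, hu, rfl, .inr ⟨l, rfl, h'⟩⟩

lemma seg_self (hf : Seg J N f a a) : f = empt := by
  rcases H.seg_cases hf with ⟨-, h⟩ | ⟨c, s, u, rfl, hu, rfl, hs⟩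
  · exact h
  · exact absurd (H.seg_le hs) (H.not_succ_le (H.seg_right_mem hs))

lemma seg_succ (hf : Seg J N f a (succ c)) (hac : le N a c) :
    ∃ s u, u ∈ J ∧ f = s ⊢ₛ (c ⊢ₛ u) ∧ Seg J N s a c := by
  rcases H.seg_cases hf with ⟨rfl, -⟩ | ⟨c', s, u, h, hu, rfl, hs⟩
  · exact absurd hac (H.not_succ_le (H.mem_of_succ_mem (H.seg_left_mem hf)))
  · obtain ⟨rfl, -⟩ := snoc_inj _ _ _ _ h
    exact ⟨s, u, hu, rfl, hs⟩

/-- The right end of a segment is determined by the segment and its left end. -/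
lemma seg_right_unique (hb : Seg J N f a b) (hc : Seg J N f a c) : b = c := by
  rcases H.seg_cases hb with ⟨rfl, rfl⟩ | ⟨b', s, u, rfl, hu, rfl, -⟩ <;>
    rcases H.seg_cases hc with ⟨rfl, h⟩ | ⟨c', s', u', rfl, hu', h, -⟩
  · rfl
  · exact absurd h.symm (snoc_ne _ _)
  · exact absurd h (snoc_ne _ _)
  · rw [(snoc_inj _ _ _ _ (snoc_inj _ _ _ _ h).2).1]

lemma shift_snoc {n s s' k u : M} (hn : n ∈ N) (hk : k ∈ N) (hsJ : s ∈ J) (hsJ' : s' ∈ J)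
    (h : IsShift J N n s s') :
    IsShift J N n (s ⊢ₛ (k ⊢ₛ u)) (s' ⊢ₛ ((n ∘ₛ k) ⊢ₛ u)) := by
  intro j hj v
  rw [H.hasValue_snoc hsJ, H.hasValue_snoc hsJ', h j hj v]
  refine or_congr (and_congr_left' ⟨fun h => ?_, fun h => ?_⟩) Iff.rfl
  · obtain ⟨h₁, rfl⟩ := snoc_inj _ _ _ _ h
    rw [H.num.add_cancel n hn k hk j hj h₁]
  · obtain ⟨rfl, rfl⟩ := snoc_inj _ _ _ _ h
    rfl

lemma segGood_empt : SegGood J N empt where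
  cat a b f g hf hg := by
    rcases H.seg_cases hg with ⟨rfl, rfl⟩ | ⟨c, s, u, h, -⟩
    · rwa [cat_empt]
    · exact absurd h.symm (snoc_ne _ _)
  ext a f g hf hg _ := by
    rcases H.seg_cases hf with ⟨rfl, rfl⟩ | ⟨c, s, u, h, -⟩
    · exact (H.seg_self hg).symm
    · exact absurd h.symm (snoc_ne _ _)
  shift n hn g hg := by
    rw [H.seg_self hg, cat_empt]
    exact ⟨empt, H.seg_empt hn, fun j _ u => iff_of_false not_hasValue_empt not_hasValue_empt⟩
  split a b g hg hab hb := by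
    rcases H.seg_cases hg with ⟨rfl, rfl⟩ | ⟨c, s, u, h, -⟩
    · obtain rfl := H.num.le_antisymm _ H.num.zero_mem b
        (H.le_right_mem H.num.zero_mem hab) hab hb
      exact ⟨empt, empt, (cat_empt _).symm, hg, hg⟩
    · exact absurd h.symm (snoc_ne _ _)
  unshift n hn g hg := by
    rw [cat_empt] at hg
    rw [H.seg_self hg]
    exact ⟨empt, H.seg_empt H.num.zero_mem,
      fun j _ u => iff_of_false not_hasValue_empt not_hasValue_empt⟩

/-- In each of the five properties, remove the last entry, apply the case `c` to what is left, and
restore the entry. This closure under successor is what `core` needs. -/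
lemma segGood_succ (hc : c ∈ N) (hg : SegGood J N c) : SegGood J N (succ c) where
  cat a b f g hf hg' := by
    rcases H.seg_cases hg' with ⟨rfl, rfl⟩ | ⟨c', s, u, h, hu, rfl, hs⟩
    · rwa [cat_empt]
    · obtain ⟨rfl, -⟩ := snoc_inj _ _ _ _ h
      rw [cat_snoc]
      exact H.seg_snoc (hg.cat a b f s hf hs) hu
  ext a f g hf hg' hv := by
    rcases H.seg_cases hf with ⟨rfl, rfl⟩ | ⟨c', s, u, h, hu, rfl, hs⟩
    · exact (H.seg_self hg').symm
    · obtain ⟨rfl, -⟩ := snoc_inj _ _ _ _ h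
      obtain ⟨s', u', hu', rfl, hs'⟩ := H.seg_succ hg' (H.seg_le hs)
      have hsJ := H.seg_mem hs
      have hsJ' := H.seg_mem hs'
      -- A segment over `[a, c)` has no value at `c`, so the last entries alone decide the value
      -- there.
      have last : ∀ {s v}, Seg J N s a c → ¬ HasValue J s c v := fun hs h =>
        H.not_succ_le hc (H.seg_range hs h).2.2
      have huu : u = u' := by
        rcases (H.hasValue_snoc hsJ').1 ((hv c u).1 ((H.hasValue_snoc hsJ).2 (.inl ⟨rfl, hu⟩)))
          with h | h
        · exact (snoc_inj _ _ _ _ h.1).2.symm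
        · exact absurd h (last hs')
      subst huu
      rw [hg.ext a s s' hs hs']
      intro j v
      have := hv j v
      rw [H.hasValue_snoc hsJ, H.hasValue_snoc hsJ'] at this
      by_cases hj : c = j
      · subst hj
        exact iff_of_false (last hs) (last hs')
      · have hne : ¬ (c ⊢ₛ u = j ⊢ₛ v ∧ v ∈ J) := fun h => hj (snoc_inj _ _ _ _ h.1).1
        simpa only [hne, false_or] using this
  shift n hn g hg' := by
    obtain ⟨s, u, hu, rfl, hs⟩ := H.seg_succ hg' (H.num.zero_le c hc)
    obtain ⟨s', hs', hv⟩ := hg.shift n hn s hs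
    refine ⟨s' ⊢ₛ ((n ∘ₛ c) ⊢ₛ u), ?_, H.shift_snoc hn hc (H.seg_mem hs) (H.seg_mem hs') hv⟩
    rw [H.num.add_succ n hn c hc]
    exact H.seg_snoc hs' hu
  split a b g hg' hab hb := by
    have hbN := H.le_right_mem (H.seg_left_mem hg') hab
    rcases (H.num.le_succ b hbN c hc).1 hb with rfl | hb
    · exact ⟨g, empt, (cat_empt _).symm, hg', H.seg_empt hbN⟩
    · obtain ⟨s, u, hu, rfl, hs⟩ := H.seg_succ hg'
        (H.num.le_trans _ (H.seg_left_mem hg') _ hbN _ hc hab hb)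
      obtain ⟨p, q, rfl, hp, hq⟩ := hg.split a b s hs hab hb
      exact ⟨p, q ⊢ₛ (c ⊢ₛ u), (cat_snoc _ _ _).symm, hp, H.seg_snoc hq hu⟩
  unshift n hn g hg' := by
    rw [H.num.add_succ n hn c hc] at hg'
    obtain ⟨s', u, hu, rfl, hs'⟩ := H.seg_succ hg' ⟨c, hc, rfl⟩
    obtain ⟨s, hs, hv⟩ := hg.unshift n hn s' hs'
    exact ⟨s ⊢ₛ (c ⊢ₛ u), H.seg_snoc hs hu,
      H.shift_snoc hn hc (H.seg_mem hs) (H.seg_mem hs') hv⟩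

end Setting

variable (M) in
theorem setting_starClass : Setting (starClass M) (numClass M) :=
  ⟨isStarClass_starClass M, isNumberClass_numClass M⟩

lemma lenClass_segGood {c : M} (hc : c ∈ lenClass J N) : SegGood J N c := (core_sub _ hc).2

variable (M) in
theorem isSubdomain_lenClass :
    IsSubdomain (numClass M) (lenClass (starClass M) (numClass M)) where
  sub _ hx := (core_sub _ hx).1
  zero_mem := core_empt (W := segClass _ _)
    ⟨(isNumberClass_numClass M).zero_mem, (setting_starClass M).segGood_empt⟩
  succ_mem x hx := core_snoc (W := segClass _ _) (fun y hy => ⟨(isNumberClass_numClass M).succ_mem y hy.1,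
    (setting_starClass M).segGood_succ hy.1 hy.2⟩) hx
  add_mem x hx y hy :=
    core_cat (fun z hz => starClass_assoc ((isNumberClass_numClass M).sub hz.1)) hx hy
  down := by
    rintro _ hx y ⟨z, hz, rfl⟩
    exact core_down (starClass_assoc ((isNumberClass_numClass M).sub hz)) hx

end Lengths

/-! ### Concatenation of indexed sequences -/

section Concatenation

variable {M : Type} [LSeq.Structure M]

/-- A star class, a number class in it, and a class of good lengths. -/
structure LenSetting (J N L : Set M) : Prop extends Setting J N where
  sub : IsSubdomain N L
  good : ∀ c ∈ L, SegGood J N c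

/-- `h` is `f` followed by the shift of `g` by the length of `f`. -/
def IsCat (J N L : Set M) (f g h : M) : Prop :=
  ∃ n ∈ L, ∃ m ∈ L, Seg J N f empt n ∧ Seg J N g empt m ∧
    ∃ g', Seg J N g' n (n ∘ₛ m) ∧ IsShift J N n g g' ∧ h = f ∘ₛ g'

variable {J N L : Set M} [SeqModel M]

namespace LenSetting

variable (H : LenSetting J N L)
variable {f g h p q r s t u v w x y z a b c d j k n m : M}
include H

lemma toN (h : n ∈ L) : n ∈ N := H.sub.sub h

lemma toJ (h : n ∈ N) : n ∈ J := H.num.sub h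

lemma zero_add (h : n ∈ N) : empt ∘ₛ n = n := H.empt_cat (H.num.sub h)

lemma add_le_cancel (hn : n ∈ N) (hj : j ∈ N) (hm : m ∈ N) (h : le N (n ∘ₛ j) (n ∘ₛ m)) :
    le N j m := by
  obtain ⟨z, hz, h⟩ := h
  rw [H.num.add_assoc n hn j hj z hz] at h
  exact ⟨z, hz, H.num.add_cancel n hn _ (H.num.add_mem j hj z hz) m hm h⟩

/-- The exceptional element `e` becomes the empty segment, and the last index `n` becomes the length
`n + 1`; downward closure of `L` leads back from `n + 1` to `n`. -/
lemma inDomain_iff : InDomain J N L f ↔ ∃ n ∈ L, Seg J N f empt n := by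
  constructor
  · rintro (rfl | ⟨n, hn, h⟩)
    · exact ⟨empt, H.sub.zero_mem, H.seg_empt H.num.zero_mem⟩
    · exact ⟨succ n, H.sub.succ_mem n hn, .inr ⟨n, rfl, h⟩⟩
  · rintro ⟨m, hm, ⟨-, -, rfl⟩ | ⟨n, rfl, h⟩⟩
    · exact .inl rfl
    · exact .inr ⟨n, H.sub.down _ hm n (H.le_succ_self h.right_mem), h⟩

lemma ext (hn : n ∈ L) (hf : Seg J N f empt n) (hg : Seg J N g empt n)
    (h : ∀ j ∈ N, ∀ v, HasValue J f j v ↔ HasValue J g j v) : f = g :=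
  (H.good n hn).ext empt f g hf hg fun j v =>
    ⟨fun hv => (h j (H.seg_range hf hv).1 v).1 hv, fun hv => (h j (H.seg_range hg hv).1 v).2 hv⟩

lemma exists_isCat (hf : InDomain J N L f) (hg : InDomain J N L g) : ∃ h, IsCat J N L f g h := by
  obtain ⟨n, hn, hf⟩ := H.inDomain_iff.1 hf
  obtain ⟨m, hm, hg⟩ := H.inDomain_iff.1 hg
  obtain ⟨g', hg', hv⟩ := (H.good m hm).shift n (H.toN hn) g hg
  exact ⟨_, n, hn, m, hm, hf, hg, g', hg', hv, rfl⟩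

/-- The class `L` is closed under addition, so gluing is available at the right end `n + m`. The
lengths hidden in `IsCat` are the given ones because a segment determines its right end. -/
lemma isCat_seg (h : IsCat J N L f g r) (hf : Seg J N f empt n) (hg : Seg J N g empt m) :
    n ∈ L ∧ m ∈ L ∧ Seg J N r empt (n ∘ₛ m) := by
  obtain ⟨n', hn', m', hm', hf', hg', g', h, -, rfl⟩ := h
  obtain rfl := H.seg_right_unique hf hf'
  obtain rfl := H.seg_right_unique hg hg'
  exact ⟨hn', hm', (H.good _ (H.sub.add_mem _ hn' _ hm')).cat _ _ _ _ hf h⟩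

lemma isCat_hasValue (h : IsCat J N L f g r) (hf : Seg J N f empt n) :
    HasValue J r j v ↔ HasValue J f j v ∨ ∃ i ∈ N, j = n ∘ₛ i ∧ HasValue J g i v := by
  obtain ⟨n', hn', m', hm', hf', hg', g', h, hs, rfl⟩ := h
  obtain rfl := H.seg_right_unique hf hf'
  rw [H.hasValue_cat (H.seg_mem hf) (H.seg_mem h)]
  refine or_congr_right ⟨fun hv => ?_, ?_⟩
  · obtain ⟨-, ⟨i, hi, rfl⟩, -⟩ := H.seg_range h hv
    exact ⟨i, hi, rfl, (hs i hi v).1 hv⟩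
  · rintro ⟨i, hi, rfl, hv⟩
    exact (hs i hi v).2 hv

lemma isCat_left (h : IsCat J N L f g r) : ∃ n ∈ L, Seg J N f empt n := by
  obtain ⟨n, hn, m, hm, hf, -⟩ := h
  exact ⟨n, hn, hf⟩

lemma isCat_right (h : IsCat J N L f g r) : ∃ m ∈ L, Seg J N g empt m := by
  obtain ⟨n, hn, m, hm, hf, hg, -⟩ := h
  exact ⟨m, hm, hg⟩

lemma isCat_inDomain (h : IsCat J N L f g r) : InDomain J N L r := by
  obtain ⟨n, hn, hf⟩ := H.isCat_left h
  obtain ⟨m, hm, hg⟩ := H.isCat_right h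
  exact H.inDomain_iff.2 ⟨_, H.sub.add_mem n hn m hm, (H.isCat_seg h hf hg).2.2⟩

lemma isCat_unique (h : IsCat J N L f g r) (h' : IsCat J N L f g s) : r = s := by
  obtain ⟨n, hn, hf⟩ := H.isCat_left h
  obtain ⟨m, hm, hg⟩ := H.isCat_right h
  refine H.ext (H.sub.add_mem n hn m hm) (H.isCat_seg h hf hg).2.2 (H.isCat_seg h' hf hg).2.2
    fun j _ v => ?_
  rw [H.isCat_hasValue h hf, H.isCat_hasValue h' hf]

/-- Both sides have length `n + m + k`, and they have the same values because associativity of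
addition matches the shifted indices. -/
lemma isCat_assoc (hp : IsCat J N L f g p) (hr : IsCat J N L p h r) (hq : IsCat J N L g h q)
    (hs : IsCat J N L f q s) : r = s := by
  obtain ⟨n, hn, hf⟩ := H.isCat_left hp
  obtain ⟨m, hm, hg⟩ := H.isCat_right hp
  obtain ⟨k, hk, hh⟩ := H.isCat_right hr
  have hn' := H.toN hn
  have hm' := H.toN hm
  have hpn := (H.isCat_seg hp hf hg).2.2
  have hqn := (H.isCat_seg hq hg hh).2.2
  have hsn := (H.isCat_seg hs hf hqn).2.2
  rw [← H.num.add_assoc n hn' m hm' k (H.toN hk)] at hsn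
  refine H.ext (H.sub.add_mem _ (H.sub.add_mem n hn m hm) k hk) (H.isCat_seg hr hpn hh).2.2 hsn
    fun j _ v => ?_
  rw [H.isCat_hasValue hr hpn, H.isCat_hasValue hs hf, H.isCat_hasValue hp hf, or_assoc]
  refine or_congr_right ?_
  simp only [H.isCat_hasValue hq hg]
  constructor
  · rintro (⟨i, hi, rfl, hv⟩ | ⟨i, hi, rfl, hv⟩)
    · exact ⟨i, hi, rfl, .inl hv⟩
    · exact ⟨m ∘ₛ i, H.num.add_mem m hm' i hi, H.num.add_assoc n hn' m hm' i hi, .inr ⟨i, hi, rfl, hv⟩⟩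
  · rintro ⟨i, hi, rfl, hv | ⟨i', hi', rfl, hv⟩⟩
    · exact .inl ⟨i, hi, rfl, hv⟩
    · exact .inr ⟨i', hi', (H.num.add_assoc n hn' m hm' i' hi').symm, hv⟩

lemma isCat_hasValue_left (h : IsCat J N L f g r) (hf : Seg J N f empt n) :
    HasValue J f j v ↔ HasValue J r j v ∧ le N (succ j) n := by
  rw [H.isCat_hasValue h hf]
  constructor
  · exact fun hv => ⟨.inl hv, (H.seg_range hf hv).2.2⟩
  · rintro ⟨hv | ⟨i, hi, rfl, hv⟩, hle⟩
    · exact hv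
    · have hn := H.seg_right_mem hf
      have hni := H.num.add_mem n hn i hi
      exact absurd (H.num.le_trans _ (H.num.succ_mem _ hni) n hn _ hni hle ⟨i, hi, rfl⟩)
        (H.not_succ_le hni)

lemma isCat_hasValue_right (h : IsCat J N L f g r) (hf : Seg J N f empt n) (hj : j ∈ N) :
    HasValue J g j v ↔ HasValue J r (n ∘ₛ j) v := by
  have hn := H.seg_right_mem hf
  rw [H.isCat_hasValue h hf]
  constructor
  · exact fun hv => .inr ⟨j, hj, rfl, hv⟩
  · rintro (hv | ⟨i, hi, hij, hv⟩)
    · have hni := H.num.add_mem n hn j hj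
      exact absurd (H.num.le_trans _ (H.num.succ_mem _ hni) n hn _ hni (H.seg_range hf hv).2.2
        ⟨j, hj, rfl⟩) (H.not_succ_le hni)
    · rwa [H.num.add_cancel n hn j hj i hi hij]

/-- With the length `n` of the first factor known, both factors are recovered from the values of the
concatenation: below `n`, and from `n` on. -/
lemma isCat_cancel (h : IsCat J N L a b r) (h' : IsCat J N L c d r) (ha : Seg J N a empt n)
    (hc : Seg J N c empt n) : a = c ∧ b = d := by
  obtain ⟨m, hm, hb⟩ := H.isCat_right h
  obtain ⟨k, hk, hd⟩ := H.isCat_right h'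
  obtain ⟨hn, -, h₁⟩ := H.isCat_seg h ha hb
  obtain ⟨-, -, h₂⟩ := H.isCat_seg h' hc hd
  obtain rfl := H.num.add_cancel n (H.toN hn) m (H.toN hm) k (H.toN hk) (H.seg_right_unique h₁ h₂)
  refine ⟨H.ext hn ha hc fun j _ v => ?_, H.ext hm hb hd fun j hj v => ?_⟩
  · rw [H.isCat_hasValue_left h ha, H.isCat_hasValue_left h' hc]
  · rw [H.isCat_hasValue_right h ha hj, H.isCat_hasValue_right h' hc hj]

lemma isCat_split (hn : n ∈ L) (hm : m ∈ L) (hf : Seg J N f empt (n ∘ₛ m)) :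
    ∃ u v, Seg J N u empt n ∧ Seg J N v empt m ∧ IsCat J N L u v f := by
  have hn' := H.toN hn
  obtain ⟨u, v', rfl, hu, hv'⟩ := (H.good _ (H.sub.add_mem n hn m hm)).split empt n f hf
    (H.num.zero_le n hn') ⟨m, H.toN hm, rfl⟩
  obtain ⟨v, hv, hs⟩ := (H.good m hm).unshift n hn' v' hv'
  exact ⟨u, v, hu, hv, n, hn, m, hm, hu, hv, v', hv', hs, rfl⟩

/-- If `c` is longer than `a` by `e`, cut `b` at `e` into `u` and `w`. Then `(a ⌢ u) ⌢ w = c ⌢ d`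
with first factors of equal length, so cancellation gives `a ⌢ u = c` and `w = d`. -/
lemma isCat_editor (h : IsCat J N L a b r) (h' : IsCat J N L c d r) :
    ∃ u, (IsCat J N L a u c ∧ IsCat J N L u d b) ∨ (IsCat J N L c u a ∧ IsCat J N L u b d) := by
  have main : ∀ {a b c d n m}, IsCat J N L a b r → IsCat J N L c d r → Seg J N a empt n →
      Seg J N c empt m → le N n m → ∃ u, IsCat J N L a u c ∧ IsCat J N L u d b := by
    intro a b c d n m h h' ha hc hnm
    obtain ⟨k, hk, hb⟩ := H.isCat_right h
    obtain ⟨l, hl, hd⟩ := H.isCat_right h'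
    obtain ⟨hn, -, h₁⟩ := H.isCat_seg h ha hb
    obtain ⟨hm, -, h₂⟩ := H.isCat_seg h' hc hd
    obtain ⟨e, he, rfl⟩ := hnm
    have hnN := H.toN hn
    have heL : e ∈ L := H.sub.down _ hm e ⟨n, hnN, H.num.add_comm e he n hnN⟩
    have hk' : k = e ∘ₛ l := by
      refine H.num.add_cancel n hnN k (H.toN hk) _ (H.num.add_mem e he l (H.toN hl)) ?_
      rw [← H.num.add_assoc n hnN e he l (H.toN hl)]
      exact H.seg_right_unique h₁ h₂
    subst hk'
    obtain ⟨u, w, hu, hw, huw⟩ := H.isCat_split heL hl hb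
    obtain ⟨p, hp⟩ := H.exists_isCat (H.inDomain_iff.2 ⟨n, hn, ha⟩) (H.inDomain_iff.2 ⟨e, heL, hu⟩)
    obtain ⟨q, hq⟩ := H.exists_isCat (H.isCat_inDomain hp) (H.inDomain_iff.2 ⟨l, hl, hw⟩)
    obtain rfl := H.isCat_assoc hp hq huw h
    obtain ⟨rfl, rfl⟩ := H.isCat_cancel hq h' (H.isCat_seg hp ha hu).2.2 hc
    exact ⟨u, hp, huw⟩
  obtain ⟨n, hn, ha⟩ := H.isCat_left h
  obtain ⟨m, hm, hc⟩ := H.isCat_left h'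
  rcases H.num.le_total n (H.toN hn) m (H.toN hm) with hnm | hnm
  · obtain ⟨u, hu⟩ := main h h' ha hc hnm
    exact ⟨u, .inl hu⟩
  · obtain ⟨u, hu⟩ := main h' h hc ha hnm
    exact ⟨u, .inr hu⟩

lemma isCat_empt_left (hg : InDomain J N L g) : IsCat J N L empt g g := by
  obtain ⟨m, hm, hg⟩ := H.inDomain_iff.1 hg
  refine ⟨empt, H.sub.zero_mem, m, hm, H.seg_empt H.num.zero_mem, hg, g, ?_, ?_, ?_⟩
  · rwa [H.zero_add (H.toN hm)]
  · intro j hj u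
    rw [H.zero_add hj]
  · exact (H.empt_cat (H.seg_mem hg)).symm

lemma isCat_empt_right (hf : InDomain J N L f) : IsCat J N L f empt f := by
  obtain ⟨n, hn, hf⟩ := H.inDomain_iff.1 hf
  refine ⟨n, hn, empt, H.sub.zero_mem, hf, H.seg_empt H.num.zero_mem, empt, ?_, ?_, ?_⟩
  · rw [cat_empt]
    exact H.seg_empt (H.toN hn)
  · exact fun j hj u => iff_of_false not_hasValue_empt not_hasValue_empt
  · exact (cat_empt f).symm

lemma isCat_of_isConcat (h : IsConcat J N L f g r) : IsCat J N L f g r := by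
  obtain ⟨n, hn, m, hm, hf, hg, -, ⟨g', hg', hv, rfl⟩, -⟩ := h
  have hm' := H.toN hm
  have hSn := H.num.succ_mem n (H.toN hn)
  refine ⟨succ n, H.sub.succ_mem n hn, succ m, H.sub.succ_mem m hm, .inr ⟨n, rfl, hf⟩,
    .inr ⟨m, rfl, hg⟩, g', .inr ⟨_, cat_snoc _ _ _, hg'⟩, fun j hj u => ?_, rfl⟩
  -- `IsConcat` controls the shift only up to `m`; beyond `m` neither sequence has a value.
  by_cases hjm : le N j m
  · exact hv j hjm u
  · exact iff_of_false (fun h => hjm (H.add_le_cancel hSn hj hm' (H.index_range hg' h).2))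
      (fun h => hjm (H.index_range hg h).2)

lemma isConcat_of_isCat (hr : IsCat J N L f g r) (hf : f ≠ empt) (hg : g ≠ empt) :
    IsConcat J N L f g r := by
  have hr' := hr
  obtain ⟨n', hn', m', hm', hfs, hgs, g', hg's, hs, rfl⟩ := hr
  have hrs := (H.isCat_seg hr' hfs hgs).2.2
  rcases hfs with ⟨-, -, h⟩ | ⟨n, rfl, hfn⟩
  · exact absurd h hf
  rcases hgs with ⟨-, -, h⟩ | ⟨m, rfl, hgm⟩
  · exact absurd h hg
  have hn := hfn.right_mem
  have hm := hgm.right_mem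
  have hSn := H.num.succ_mem n hn
  -- Addition recurses on its right argument, so this needs commutativity.
  have hcomm : succ n ∘ₛ m = succ (n ∘ₛ m) := by
    rw [H.num.add_comm _ hSn m hm, H.num.add_succ m hm n hn, H.num.add_comm m hm n hn]
  have key : succ n ∘ₛ succ m = succ (succ n ∘ₛ m) := cat_snoc _ _ _
  rw [key] at hg's hrs
  have hg'i : IsIndexed J N g' (succ n) (succ n ∘ₛ m) := by
    rcases hg's with ⟨-, h, -⟩ | ⟨k, hk, h⟩
    · refine absurd (?_ : le N (succ (succ n ∘ₛ m)) _) (H.not_succ_le (H.num.add_mem _ hSn m hm))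
      rw [h]
      exact ⟨m, hm, rfl⟩
    · rwa [(snoc_inj _ _ _ _ hk).1]
  have hri : IsIndexed J N (f ∘ₛ g') empt (succ (n ∘ₛ m)) := by
    rcases hrs with ⟨-, h, -⟩ | ⟨k, hk, h⟩
    · exact absurd h (snoc_ne _ _)
    · rwa [← hcomm, (snoc_inj _ _ _ _ hk).1]
  refine ⟨n, H.sub.down _ hn' n (H.le_succ_self hn), m, H.sub.down _ hm' m (H.le_succ_self hm),
    hfn, hgm, hri, ⟨g', hg'i, ?_, rfl⟩, ?_, ?_⟩
  · intro j hj u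
    exact hs j (H.num.down m hm j hj) u
  · intro j hj u
    have hjN := H.num.down n hn j hj
    rw [H.isCat_hasValue_left hr' (.inr ⟨n, rfl, hfn⟩)]
    exact (and_iff_left (H.succ_le_succ hjN hn hj)).symm
  · intro j hj u
    exact (H.isCat_hasValue_right hr' (.inr ⟨n, rfl, hfn⟩) (H.num.down m hm j hj)).symm

lemma isConcatE_iff (hf : InDomain J N L f) (hg : InDomain J N L g) :
    IsConcatE J N L f g r ↔ IsCat J N L f g r := by
  constructor
  · rintro (⟨rfl, rfl⟩ | ⟨rfl, rfl⟩ | h)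
    · exact H.isCat_empt_left hg
    · exact H.isCat_empt_right hf
    · exact H.isCat_of_isConcat h
  · intro h
    by_cases hfe : f = empt
    · subst hfe
      exact .inl ⟨rfl, H.isCat_unique h (H.isCat_empt_left hg)⟩
    by_cases hge : g = empt
    · subst hge
      exact .inr (.inl ⟨rfl, H.isCat_unique h (H.isCat_empt_right hf)⟩)
    exact .inr (.inr (H.isConcat_of_isCat h hfe hge))

end LenSetting

end Concatenation

/-! ### The axioms read in a structure -/

section Sentences

variable {M : Type} [LSeq.Structure M]

lemma realize_seq1 : M ⊨ seq1 ↔ ∀ x y : M, x ⊢ₛ y ≠ empt := by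
  simp [seq1, Sentence.Realize, Formula.Realize, realize_eT, realize_snocT, Fin.snoc]

lemma realize_seq2 : M ⊨ seq2 ↔
    ∀ x₁ x₂ y₁ y₂ : M, x₁ ⊢ₛ x₂ = y₁ ⊢ₛ y₂ → x₁ = y₁ ∧ x₂ = y₂ := by
  simp [seq2, Sentence.Realize, Formula.Realize, realize_snocT, Fin.snoc]

lemma realize_seq3 : M ⊨ seq3 ↔ ∀ x : M, x ∘ₛ empt = x := by
  simp [seq3, Sentence.Realize, Formula.Realize, realize_eT, realize_catT, Fin.snoc]

lemma realize_seq4 : M ⊨ seq4 ↔ ∀ x y z : M, x ∘ₛ (y ⊢ₛ z) = (x ∘ₛ y) ⊢ₛ z := by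
  simp [seq4, Sentence.Realize, Formula.Realize, realize_snocT, realize_catT, Fin.snoc]

lemma realize_seq5 : M ⊨ seq5 ↔ ∀ x : M, x = empt ∨ ∃ y z, x = y ⊢ₛ z := by
  simp [seq5, Sentence.Realize, Formula.Realize, realize_eT, realize_snocT, Fin.snoc]

lemma realize_seqStar3 : M ⊨ seqStar3 ↔ ∀ x : M, x ∘ₛ empt = x ∧ empt ∘ₛ x = x := by
  simp [seqStar3, Sentence.Realize, Formula.Realize, realize_eT, realize_catT, Fin.snoc]

lemma realize_seqStar5 : M ⊨ seqStar5 ↔ ∀ x y z w : M, x ∘ₛ y = z ∘ₛ w ↔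
    ∃ u, (z = x ∘ₛ u ∧ u ∘ₛ w = y) ∨ (x = z ∘ₛ u ∧ u ∘ₛ y = w) := by
  simp [seqStar5, Sentence.Realize, Formula.Realize, realize_catT, Fin.snoc]

lemma realize_seqCancel : M ⊨ seqCancel ↔
    ∀ x y z : M, x ∘ₛ y = x ∘ₛ z ∨ y ∘ₛ x = z ∘ₛ x → y = z := by
  simp [seqCancel, Sentence.Realize, Formula.Realize, realize_catT, Fin.snoc]

lemma seqModel_of_models (h : M ⊨ Seq) : SeqModel M where
  snoc_ne := realize_seq1.1 (h.realize_of_mem _ (by simp [Seq]))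
  snoc_inj := realize_seq2.1 (h.realize_of_mem _ (by simp [Seq]))
  cat_empt := realize_seq3.1 (h.realize_of_mem _ (by simp [Seq]))
  cat_snoc := realize_seq4.1 (h.realize_of_mem _ (by simp [Seq]))
  cases := realize_seq5.1 (h.realize_of_mem _ (by simp [Seq]))

end Sentences

/-! ### Coding elements of `J` by the domain, and the model of `Seq⁺` -/

section Coding

variable {M : Type} [LSeq.Structure M]

/-- `x` is the `k`-th member of the tower of singletons that starts above `y ∈ J \ D`. -/
def InTower (J N D : Set M) (x k y : M) : Prop :=
  k ∈ N ∧ y ∈ J ∧ y ∉ D ∧ x = single (k ⊢ₛ y)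

/-- The graph of a bijection from `J` onto `D`. -/
def Code (J N D : Set M) (x g : M) : Prop :=
  (x ∉ D ∧ g = single (empt ⊢ₛ x)) ∨
  (∃ k y, InTower J N D x k y ∧ g = single (succ k ⊢ₛ y)) ∨
  (x ∈ D ∧ g = x ∧ ¬ ∃ k y, InTower J N D x k y)

/-- `h` is `f` with the element that is coded by `g` appended. -/
def IsSnoc (J N L : Set M) (f g h : M) : Prop :=
  ∃ x ∈ J, Code J N {f | InDomain J N L f} x g ∧ IsCat J N L f (single x) h

variable {J N L : Set M} [SeqModel M]

lemma single_inj {x y : M} (h : single x = single y) : x = y :=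
  (snoc_inj _ _ _ _ (snoc_inj _ _ _ _ h).2).2

lemma InTower.unique {D : Set M} {x k y k' y' : M} (h : InTower J N D x k y)
    (h' : InTower J N D x k' y') : k = k' ∧ y = y' :=
  snoc_inj _ _ _ _ (single_inj (h.2.2.2.symm.trans h'.2.2.2))

namespace LenSetting

variable (H : LenSetting J N L)
variable {f g h x y k : M}
include H

lemma seg_single (hx : x ∈ J) : Seg J N (single x) empt (succ empt) :=
  .inr ⟨empt, rfl, H.isIndexed_singleton H.num.zero_mem hx⟩

lemma succ_zero_mem : succ empt ∈ L := H.sub.succ_mem _ H.sub.zero_mem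

lemma single_inDomain (hx : x ∈ J) : InDomain J N L (single x) :=
  .inr ⟨empt, H.sub.zero_mem, H.isIndexed_singleton H.num.zero_mem hx⟩

lemma mem_of_inDomain (hf : InDomain J N L f) : f ∈ J := by
  obtain ⟨n, hn, hf⟩ := H.inDomain_iff.1 hf
  exact H.seg_mem hf

lemma inTower_inDomain (h : InTower J N {f | InDomain J N L f} x k y) : InDomain J N L x := by
  rw [h.2.2.2]
  exact H.single_inDomain (H.snoc_mem (H.toJ h.1) y)

lemma exists_code :
    ∃ g, InDomain J N L g ∧ Code J N {f | InDomain J N L f} x g := by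
  by_cases hD : InDomain J N L x
  · by_cases ht : ∃ k y, InTower J N {f | InDomain J N L f} x k y
    · obtain ⟨k, y, h⟩ := ht
      exact ⟨_, H.single_inDomain (H.snoc_mem (H.toJ (H.num.succ_mem k h.1)) y),
        .inr (.inl ⟨k, y, h, rfl⟩)⟩
    · exact ⟨x, hD, .inr (.inr ⟨hD, rfl, ht⟩)⟩
  · exact ⟨_, H.single_inDomain (H.star.singleton_mem x), .inl ⟨hD, rfl⟩⟩

lemma code_unique {g' : M} (h : Code J N {f | InDomain J N L f} x g)
    (h' : Code J N {f | InDomain J N L f} x g') : g = g' := by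
  rcases h with ⟨hx, rfl⟩ | ⟨k, y, ht, rfl⟩ | ⟨hx, rfl, ht⟩ <;>
    rcases h' with ⟨hx', rfl⟩ | ⟨k', y', ht', rfl⟩ | ⟨hx', rfl, ht'⟩
  · rfl
  · exact absurd (H.inTower_inDomain ht') hx
  · exact absurd hx' hx
  · exact absurd (H.inTower_inDomain ht) hx'
  · obtain ⟨rfl, rfl⟩ := ht.unique ht'
    rfl
  · exact absurd ⟨k, y, ht⟩ ht'
  · exact absurd hx hx'
  · exact absurd ⟨k', y', ht'⟩ ht
  · rfl

/-- The first two clauses produce tower elements, of height `0` and `k + 1`, the third never does; a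
tower element determines its height and base. Membership in `J` lets an `x ∉ D` be the base of a
tower. -/
lemma code_inj (hx : x ∈ J) (hy : y ∈ J) (h : Code J N {f | InDomain J N L f} x g)
    (h' : Code J N {f | InDomain J N L f} y g) : x = y := by
  have clash : ∀ {x y : M}, x ∈ J →
      (x ∉ {f | InDomain J N L f} ∧ g = single (empt ⊢ₛ x) ∨
        ∃ k y, InTower J N {f | InDomain J N L f} x k y ∧ g = single (succ k ⊢ₛ y)) →
      ¬ (y ∈ {f | InDomain J N L f} ∧ g = y ∧
        ¬ ∃ k z, InTower J N {f | InDomain J N L f} y k z) := by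
    rintro x y hx (⟨hD, rfl⟩ | ⟨k, z, ht, rfl⟩) ⟨-, h', hn⟩
    · exact hn ⟨empt, x, H.num.zero_mem, hx, hD, h'.symm⟩
    · exact hn ⟨succ k, z, H.num.succ_mem k ht.1, ht.2.1, ht.2.2.1, h'.symm⟩
  rcases or_assoc.2 h with h₀ | h₀ <;> rcases or_assoc.2 h' with h₀' | h₀'
  · rcases h₀ with ⟨-, rfl⟩ | ⟨k, z, ht, rfl⟩ <;>
      rcases h₀' with ⟨-, he⟩ | ⟨k', z', ht', he⟩ <;>
      obtain ⟨h₁, h₂⟩ := snoc_inj _ _ _ _ (single_inj he)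
    · exact h₂
    · exact absurd h₁.symm (snoc_ne _ _)
    · exact absurd h₁ (snoc_ne _ _)
    · rw [ht.2.2.2, ht'.2.2.2, h₂, (snoc_inj _ _ _ _ h₁).1]
  · exact absurd h₀' (clash hx h₀)
  · exact absurd h₀ (clash hy h₀')
  · exact h₀.2.1.symm.trans h₀'.2.1

/-- Decoding moves one step down the tower: height `l + 1` to height `l`, height `0` to the base.
Off the towers it is the identity. -/
lemma exists_decode (hg : InDomain J N L g) :
    ∃ x ∈ J, Code J N {f | InDomain J N L f} x g := by
  by_cases ht : ∃ k y, InTower J N {f | InDomain J N L f} g k y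
  · obtain ⟨k, y, hk, hy, hyD, rfl⟩ := ht
    by_cases hk0 : k = empt
    · subst hk0
      exact ⟨y, hy, .inl ⟨hyD, rfl⟩⟩
    · obtain ⟨l, hl, rfl⟩ := H.num.exists_pred k hk hk0
      have hlJ := H.snoc_mem (H.toJ hl) y
      exact ⟨single (l ⊢ₛ y), H.star.singleton_mem _,
        .inr (.inl ⟨l, y, ⟨hl, hy, hyD, rfl⟩, rfl⟩)⟩
  · exact ⟨g, H.mem_of_inDomain hg, .inr (.inr ⟨hg, rfl, ht⟩)⟩

lemma exists_isSnoc (hf : InDomain J N L f) (hg : InDomain J N L g) : ∃ h, IsSnoc J N L f g h := by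
  obtain ⟨x, hx, hc⟩ := H.exists_decode hg
  obtain ⟨h, hh⟩ := H.exists_isCat hf (H.single_inDomain hx)
  exact ⟨h, x, hx, hc, hh⟩

lemma isSnoc_inDomain (h : IsSnoc J N L f g x) : InDomain J N L x := by
  obtain ⟨y, -, -, h⟩ := h
  exact H.isCat_inDomain h

lemma isSnoc_unique (hh : IsSnoc J N L f g x) (hh' : IsSnoc J N L f g y) : x = y := by
  obtain ⟨z, hz, hc, h⟩ := hh
  obtain ⟨z', hz', hc', h'⟩ := hh'
  obtain rfl := H.code_inj hz hz' hc hc'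
  exact H.isCat_unique h h'

/-- A structure in which the operations are concatenation of indexed sequences and appending a
coded element is a model of `Seq⁺`. -/
theorem models_seqPlus {X : Type} [LSeq.Structure X] {i : X → M} (hi : Function.Injective i)
    (hdom : ∀ x, InDomain J N L (i x)) (hsurj : ∀ f, InDomain J N L f → ∃ x, i x = f)
    (hempt : i empt = empt) (hcat : ∀ x y, IsCat J N L (i x) (i y) (i (x ∘ₛ y)))
    (hsnoc : ∀ x y, IsSnoc J N L (i x) (i y) (i (x ⊢ₛ y))) : X ⊨ SeqPlus := by
  have cat_of : ∀ {x y z}, IsCat J N L (i x) (i y) (i z) → x ∘ₛ y = z := fun h =>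
    hi (H.isCat_unique (hcat _ _) h)
  have e_right : ∀ x : X, x ∘ₛ empt = x := fun x => cat_of (by
    rw [hempt]
    exact H.isCat_empt_right (hdom x))
  have e_left : ∀ x : X, empt ∘ₛ x = x := fun x => cat_of (by
    rw [hempt]
    exact H.isCat_empt_left (hdom x))
  have assoc : ∀ x y z : X, (x ∘ₛ y) ∘ₛ z = x ∘ₛ (y ∘ₛ z) := fun x y z =>
    hi (H.isCat_assoc (hcat x y) (hcat _ z) (hcat y z) (hcat x _))
  -- Appending `a` is concatenation with one singleton `b`, the same for every left argument; the
  -- axioms for `⊢` thus reduce to facts about `∘` and the code.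
  have snoc_cat : ∀ x a : X, ∃ w ∈ J, Code J N {f | InDomain J N L f} w (i a) ∧
      ∃ b : X, i b = single w ∧ ∀ x, x ⊢ₛ a = x ∘ₛ b := by
    intro x a
    obtain ⟨w, hw, hc, -⟩ := hsnoc x a
    obtain ⟨b, hb⟩ := hsurj _ (H.single_inDomain hw)
    refine ⟨w, hw, hc, b, hb, fun y => hi (H.isSnoc_unique (hsnoc y a) ⟨w, hw, hc, ?_⟩)⟩
    rw [← hb]
    exact hcat y b
  have len : ∀ x : X, ∃ n ∈ L, Seg J N (i x) empt n := fun x => H.inDomain_iff.1 (hdom x)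
  have cancel : ∀ {x y z w : X} {n}, x ∘ₛ y = z ∘ₛ w → Seg J N (i x) empt n →
      Seg J N (i z) empt n → x = z ∧ y = w := by
    intro x y z w n h hx hz
    have h' := hcat z w
    rw [← h] at h'
    obtain ⟨h₁, h₂⟩ := H.isCat_cancel (hcat x y) h' hx hz
    exact ⟨hi h₁, hi h₂⟩
  -- Equal lengths on the right force equal lengths on the left, by commutativity and cancellation
  -- of addition.
  have cancel_right : ∀ {x y z w : X} {m}, x ∘ₛ y = z ∘ₛ w → Seg J N (i y) empt m →
      Seg J N (i w) empt m → x = z ∧ y = w := by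
    intro x y z w m h hy hw
    obtain ⟨n, hn, hx⟩ := len x
    obtain ⟨k, hk, hz⟩ := len z
    obtain ⟨-, hm, h₁⟩ := H.isCat_seg (hcat x y) hx hy
    have h₂ := (H.isCat_seg (hcat z w) hz hw).2.2
    rw [← h] at h₂
    have hnk := H.seg_right_unique h₁ h₂
    rw [H.num.add_comm n (H.toN hn) m (H.toN hm), H.num.add_comm k (H.toN hk) m (H.toN hm)] at hnk
    obtain rfl := H.num.add_cancel m (H.toN hm) n (H.toN hn) k (H.toN hk) hnk
    exact cancel h hx hz
  have snoc_ne' : ∀ x y : X, x ⊢ₛ y ≠ empt := by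
    intro x a h
    obtain ⟨w, hw, -, b, hb, hx⟩ := snoc_cat x a
    obtain ⟨n, hn, hxn⟩ := len x
    have hs := H.seg_single hw
    rw [← hb] at hs
    have h' := (H.isCat_seg (hcat x b) hxn hs).2.2
    rw [← hx, h, hempt] at h'
    have := H.seg_right_unique (H.seg_empt H.num.zero_mem) h'
    exact snoc_ne _ _ (cat_eq_empt this.symm).2
  simp only [SeqPlus, Seq, Set.insert_union, Set.singleton_union, Theory.model_insert_iff,
    Theory.model_singleton_iff, realize_seq1, realize_seq2, realize_seq3, realize_seq4,
    realize_seq5, realize_seqStar3, realize_seqStar5, realize_seqCancel]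
  refine ⟨snoc_ne', ?_, e_right, ?_, ?_, fun x => ⟨e_right x, e_left x⟩, ?_, ?_⟩
  · intro x₁ a x₂ a' h
    obtain ⟨w, hw, hc, b, hb, hx⟩ := snoc_cat x₁ a
    obtain ⟨w', hw', hc', b', hb', hx'⟩ := snoc_cat x₂ a'
    rw [hx, hx'] at h
    have hs := H.seg_single hw
    have hs' := H.seg_single hw'
    rw [← hb] at hs
    rw [← hb'] at hs'
    obtain ⟨h₁, rfl⟩ := cancel_right h hs hs'
    rw [hb] at hb'
    obtain rfl := single_inj hb'
    exact ⟨h₁, hi (H.code_unique hc hc')⟩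
  · intro x y a
    obtain ⟨w, hw, hc, b, hb, hx⟩ := snoc_cat x a
    rw [hx, hx, assoc]
  · intro x
    obtain ⟨n, hn, hx⟩ := len x
    by_cases hn0 : n = empt
    · subst hn0
      exact .inl (hi ((H.seg_self hx).trans hempt.symm))
    · obtain ⟨m, hm, rfl⟩ := H.num.exists_pred n (H.toN hn) hn0
      have hmL := H.sub.down _ hn m (H.le_succ_self hm)
      -- Writing the length as `m + 1` lets a piece of length one be split off; its only entry `w`
      -- is then encoded by an element of the domain.
      rw [show succ m = m ∘ₛ succ empt from (cat_single m empt).symm] at hx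
      obtain ⟨u, v, hu, hv, huv⟩ := H.isCat_split hmL H.succ_zero_mem hx
      obtain ⟨s, w, hw, rfl, hs⟩ := H.seg_succ hv (H.num.le_refl _ H.num.zero_mem)
      obtain rfl := H.seg_self hs
      obtain ⟨y, rfl⟩ := hsurj u (H.inDomain_iff.2 ⟨m, hmL, hu⟩)
      obtain ⟨g, hg, hc⟩ := H.exists_code (x := w)
      obtain ⟨a, rfl⟩ := hsurj g hg
      exact .inr ⟨y, a, hi (H.isSnoc_unique ⟨w, hw, hc, huv⟩ (hsnoc y a))⟩
  · intro x y z w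
    constructor
    · intro h
      have h' := hcat z w
      rw [← h] at h'
      obtain ⟨u, ⟨h₁, h₂⟩ | ⟨h₁, h₂⟩⟩ := H.isCat_editor (hcat x y) h'
      all_goals
        obtain ⟨n, hn, hu⟩ := H.isCat_right h₁
        obtain ⟨u, rfl⟩ := hsurj u (H.inDomain_iff.2 ⟨n, hn, hu⟩)
      · exact ⟨u, .inl ⟨(cat_of h₁).symm, cat_of h₂⟩⟩
      · exact ⟨u, .inr ⟨(cat_of h₁).symm, cat_of h₂⟩⟩
    · rintro ⟨u, ⟨rfl, rfl⟩ | ⟨rfl, rfl⟩⟩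
      · exact (assoc _ _ _).symm
      · exact assoc _ _ _
  · rintro x y z (h | h)
    · obtain ⟨n, hn, hx⟩ := len x
      exact (cancel h hx hx).2
    · obtain ⟨n, hn, hx⟩ := len x
      exact (cancel_right h hx hx).1

end LenSetting
end Coding

/-! ### Uniform definability of the classes and relations -/

section Definability

variable {α : Type} {J N L W : ∀ (M : Type) [LSeq.Structure M], Set M}
  {a b c f g h m n k u x y : ∀ (M : Type) [LSeq.Structure M], (α → M) → M}

/-- A class that is defined by a formula, uniformly in all structures. -/
def UClass (C : ∀ (M : Type) [LSeq.Structure M], Set M) : Prop :=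
  UDef (α := Fin 1) (fun M _ v => v 0 ∈ C M)

lemma UClass.mem (hC : UClass W) (hf : UTerm f) : UDef (fun M _ v => f M v ∈ W M) :=
  UDef.mem hC hf

/-- As in the definability proofs below, the class is unfolded to quantifiers and connectives, and
the closure lemmas follow the syntax. -/
lemma uClass_assocClass : UClass (fun M _ => assocClass M) := by
  change UDef (fun M _ v => ∀ x y : M, (x ∘ₛ y) ∘ₛ v 0 = x ∘ₛ (y ∘ₛ v 0))
  repeat'
    first
    | assumption | apply UTerm.cat | apply UTerm.var | apply UDef.all | apply UDef.eq

lemma uClass_hered (hW : UClass W) : UClass (fun M _ => hered (W M)) := by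
  change UDef (fun M _ v => ∀ y z : M, y ∘ₛ z = v 0 → y ∈ W M)
  repeat'
    first
    | assumption | apply hW.mem | apply UTerm.cat | apply UTerm.var | apply UDef.all
    | apply UDef.imp | apply UDef.eq

lemma uClass_core (hW : UClass W) : UClass (fun M _ => core (W M)) := by
  change UDef (fun M _ v => v 0 ∈ hered (W M) ∧ ∀ y ∈ hered (W M), y ∘ₛ v 0 ∈ hered (W M))
  repeat'
    first
    | assumption | apply (uClass_hered hW).mem | apply UTerm.cat | apply UTerm.var
    | apply UDef.and | apply UDef.all | apply UDef.imp

lemma uClass_editorClass : UClass (fun M _ => editorClass M) := by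
  change UDef (fun M _ v => v 0 ∈ assocClass M ∧ empt ∘ₛ v 0 = v 0 ∧
    ∀ x y z : M, x ∘ₛ y = z ∘ₛ v 0 →
      ∃ u, (z = x ∘ₛ u ∧ u ∘ₛ v 0 = y) ∨ (x = z ∘ₛ u ∧ u ∘ₛ y = v 0))
  repeat'
    first
    | assumption | apply uClass_assocClass.mem | apply UTerm.cat | apply UTerm.empt
    | apply UTerm.var | apply UDef.and | apply UDef.or | apply UDef.all | apply UDef.ex
    | apply UDef.imp | apply UDef.eq

lemma uClass_starClass : UClass (fun M _ => starClass M) := uClass_core uClass_editorClass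

lemma uClass_preNumClass : UClass (fun M _ => preNumClass M) := by
  change UDef (fun M _ v => v 0 ∈ starClass M ∧
    (empt ⊢ₛ empt) ∘ₛ v 0 = succ (v 0) ∧ (v 0 = empt ∨ ∃ y : M, v 0 = succ y) ∧
    ∀ y z : M, y ∘ₛ v 0 = z ∘ₛ v 0 → y = z)
  repeat'
    first
    | assumption | apply uClass_starClass.mem | apply UTerm.succ | apply UTerm.cat
    | apply UTerm.snoc | apply UTerm.empt | apply UTerm.var | apply UDef.and | apply UDef.or
    | apply UDef.all | apply UDef.ex | apply UDef.imp | apply UDef.eq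

lemma uClass_commClass : UClass (fun M _ => commClass M) := by
  change UDef (fun M _ v => v 0 ∈ preNumClass M ∧
    ∀ y ∈ preNumClass M, v 0 ∘ₛ y = y ∘ₛ v 0)
  repeat'
    first
    | assumption | apply uClass_preNumClass.mem | apply UTerm.cat | apply UTerm.var
    | apply UDef.and | apply UDef.all | apply UDef.imp | apply UDef.eq

lemma uClass_numClass : UClass (fun M _ => numClass M) := uClass_core uClass_commClass

lemma udef_le (hN : UClass N) (hf : UTerm f) (hg : UTerm g) :
    UDef (fun M _ v => le (N M) (f M v) (g M v)) := by
  change UDef (fun M _ v => ∃ z ∈ N M, f M v ∘ₛ z = g M v)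
  repeat'
    first
    | assumption | apply hN.mem | apply UTerm.cat | apply UTerm.var | apply UTerm.weaken
    | apply UDef.and | apply UDef.ex | apply UDef.eq

lemma udef_lt (hN : UClass N) (hf : UTerm f) (hg : UTerm g) :
    UDef (fun M _ v => lt (N M) (f M v) (g M v)) := by
  change UDef (fun M _ v => le (N M) (f M v) (g M v) ∧ f M v ≠ g M v)
  repeat'
    first
    | assumption | apply udef_le hN | apply UTerm.var | apply UTerm.weaken | apply UDef.and
    | apply UDef.not | apply UDef.eq

lemma udef_hasValue (hJ : UClass J) (hf : UTerm f) (hk : UTerm k) (hu : UTerm u) :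
    UDef (fun M _ v => HasValue (J M) (f M v) (k M v) (u M v)) := by
  change UDef (fun M _ v => u M v ∈ J M ∧
    ∃ s ∈ J M, ∃ t ∈ J M, f M v = (s ⊢ₛ (k M v ⊢ₛ u M v)) ∘ₛ t)
  repeat'
    first
    | assumption | apply hJ.mem | apply UTerm.cat | apply UTerm.snoc | apply UTerm.var
    | apply UTerm.weaken | apply UDef.and | apply UDef.ex | apply UDef.eq

/-- The closure lemmas match logical connectives, so the structure is needed as a conjunction. -/
lemma isIndexed_iff {M : Type} [LSeq.Structure M] {J N : Set M} {f m n : M} :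
    IsIndexed J N f m n ↔ f ∈ J ∧ m ∈ N ∧ n ∈ N ∧ le N m n ∧
      (∀ k, le N m k → le N k n → ∃ u, HasValue J f k u) ∧
      (∀ s ∈ J, ∀ t ∈ J, ∀ w : M, f = (s ⊢ₛ w) ∘ₛ t →
        ∃ k u, le N m k ∧ le N k n ∧ u ∈ J ∧ w = k ⊢ₛ u) ∧
      (∀ s ∈ J, ∀ t ∈ J, ∀ k ∈ J, ∀ u ∈ J, f = (s ⊢ₛ (k ⊢ₛ u)) ∘ₛ t → s ≠ empt →
        lt N m k ∧ ∃ l ∈ J, ∃ v ∈ J, ∃ s₀ ∈ J, k = succ l ∧ s = s₀ ⊢ₛ (l ⊢ₛ v)) ∧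
      (∀ s ∈ J, ∀ t ∈ J, ∀ k ∈ J, ∀ u ∈ J, f = (s ⊢ₛ (k ⊢ₛ u)) ∘ₛ t →
        ¬ ∃ k' ∈ N, le N k k' ∧ ∃ u' ∈ J, ∃ s₀ ∈ J, ∃ t₀ ∈ J,
          s = (s₀ ⊢ₛ (k' ⊢ₛ u')) ∘ₛ t₀) :=
  ⟨fun ⟨h₁, h₂, h₃, h₄, h₅, h₆, h₇, h₈⟩ => ⟨h₁, h₂, h₃, h₄, h₅, h₆, h₇, h₈⟩,
    fun ⟨h₁, h₂, h₃, h₄, h₅, h₆, h₇, h₈⟩ => ⟨h₁, h₂, h₃, h₄, h₅, h₆, h₇, h₈⟩⟩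

lemma udef_isIndexed (hJ : UClass J) (hN : UClass N)
    (hf : UTerm f) (hm : UTerm m) (hn : UTerm n) :
    UDef (fun M _ v => IsIndexed (J M) (N M) (f M v) (m M v) (n M v)) := by
  simp only [isIndexed_iff]
  repeat'
    first
    | assumption | apply hJ.mem | apply hN.mem | apply udef_le hN | apply udef_lt hN
    | apply udef_hasValue hJ | apply UTerm.succ | apply UTerm.single | apply UTerm.cat
    | apply UTerm.snoc | apply UTerm.empt | apply UTerm.var | apply UTerm.weaken | apply UDef.and
    | apply UDef.or | apply UDef.not | apply UDef.iff | apply UDef.all | apply UDef.ex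
    | apply UDef.imp | apply UDef.eq

lemma udef_seg (hJ : UClass J) (hN : UClass N)
    (hf : UTerm f) (ha : UTerm a) (hb : UTerm b) :
    UDef (fun M _ v => Seg (J M) (N M) (f M v) (a M v) (b M v)) := by
  change UDef (fun M _ v => (a M v ∈ N M ∧ b M v = a M v ∧ f M v = empt) ∨
    ∃ n, b M v = succ n ∧ IsIndexed (J M) (N M) (f M v) (a M v) n)
  repeat'
    first
    | assumption | apply hN.mem | apply udef_isIndexed hJ hN | apply UTerm.succ | apply UTerm.empt
    | apply UTerm.var | apply UTerm.weaken | apply UDef.and | apply UDef.or | apply UDef.ex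
    | apply UDef.eq

lemma udef_isShift (hJ : UClass J) (hN : UClass N)
    (hn : UTerm n) (hf : UTerm f) (hg : UTerm g) :
    UDef (fun M _ v => IsShift (J M) (N M) (n M v) (f M v) (g M v)) := by
  change UDef (fun M _ v => ∀ j ∈ N M, ∀ u,
    HasValue (J M) (g M v) (n M v ∘ₛ j) u ↔ HasValue (J M) (f M v) j u)
  repeat'
    first
    | assumption | apply hN.mem | apply udef_hasValue hJ | apply UTerm.cat | apply UTerm.var
    | apply UTerm.weaken | apply UDef.iff | apply UDef.all | apply UDef.imp

lemma segGood_iff {M : Type} [LSeq.Structure M] {J N : Set M} {c : M} :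
    SegGood J N c ↔
      (∀ a b f g, Seg J N f a b → Seg J N g b c → Seg J N (f ∘ₛ g) a c) ∧
      (∀ a f g, Seg J N f a c → Seg J N g a c →
        (∀ j u, HasValue J f j u ↔ HasValue J g j u) → f = g) ∧
      (∀ n ∈ N, ∀ g, Seg J N g empt c → ∃ g', Seg J N g' n (n ∘ₛ c) ∧ IsShift J N n g g') ∧
      (∀ a b g, Seg J N g a c → le N a b → le N b c →
        ∃ u v, g = u ∘ₛ v ∧ Seg J N u a b ∧ Seg J N v b c) ∧
      (∀ n ∈ N, ∀ g', Seg J N g' n (n ∘ₛ c) → ∃ g, Seg J N g empt c ∧ IsShift J N n g g') :=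
  ⟨fun ⟨h₁, h₂, h₃, h₄, h₅⟩ => ⟨h₁, h₂, h₃, h₄, h₅⟩,
    fun ⟨h₁, h₂, h₃, h₄, h₅⟩ => ⟨h₁, h₂, h₃, h₄, h₅⟩⟩

lemma udef_segGood (hJ : UClass J) (hN : UClass N)
    (hc : UTerm c) :
    UDef (fun M _ v => SegGood (J M) (N M) (c M v)) := by
  simp only [segGood_iff]
  repeat'
    first
    | assumption | apply hN.mem | apply udef_le hN | apply udef_seg hJ hN
    | apply udef_isShift hJ hN | apply udef_hasValue hJ | apply UTerm.succ | apply UTerm.single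
    | apply UTerm.cat | apply UTerm.snoc | apply UTerm.empt | apply UTerm.var | apply UTerm.weaken
    | apply UDef.and | apply UDef.or | apply UDef.not | apply UDef.iff | apply UDef.all
    | apply UDef.ex | apply UDef.imp | apply UDef.eq

lemma uClass_lenClass (hJ : UClass J) (hN : UClass N) :
    UClass (fun M _ => lenClass (J M) (N M)) :=
  uClass_core (UDef.and hN (udef_segGood hJ hN (.var 0)))

lemma udef_inDomain (hJ : UClass J) (hN : UClass N) (hL : UClass L)
    (hf : UTerm f) :
    UDef (fun M _ v => InDomain (J M) (N M) (L M) (f M v)) := by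
  change UDef (fun M _ v => f M v = empt ∨
    ∃ n ∈ L M, IsIndexed (J M) (N M) (f M v) empt n)
  repeat'
    first
    | assumption | apply hL.mem | apply udef_isIndexed hJ hN | apply UTerm.empt | apply UTerm.var
    | apply UTerm.weaken | apply UDef.and | apply UDef.or | apply UDef.ex | apply UDef.eq

lemma udef_isCat (hJ : UClass J) (hN : UClass N) (hL : UClass L)
    (hf : UTerm f) (hg : UTerm g) (hh : UTerm h) :
    UDef (fun M _ v => IsCat (J M) (N M) (L M) (f M v) (g M v) (h M v)) := by
  change UDef (fun M _ v => ∃ n ∈ L M, ∃ m ∈ L M,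
    Seg (J M) (N M) (f M v) empt n ∧ Seg (J M) (N M) (g M v) empt m ∧
    ∃ g', Seg (J M) (N M) g' n (n ∘ₛ m) ∧ IsShift (J M) (N M) n (g M v) g' ∧ h M v = f M v ∘ₛ g')
  repeat'
    first
    | assumption | apply hL.mem | apply udef_seg hJ hN | apply udef_isShift hJ hN
    | apply UTerm.cat | apply UTerm.empt | apply UTerm.var | apply UTerm.weaken | apply UDef.and
    | apply UDef.ex | apply UDef.eq

lemma udef_inTower (hJ : UClass J) (hN : UClass N)
    (hW : UClass W) (hx : UTerm x) (hk : UTerm k) (hy : UTerm y) :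
    UDef (fun M _ v => InTower (J M) (N M) (W M) (x M v) (k M v) (y M v)) := by
  change UDef (fun M _ v => k M v ∈ N M ∧ y M v ∈ J M ∧ ¬ y M v ∈ W M ∧
    x M v = single (k M v ⊢ₛ y M v))
  repeat'
    first
    | assumption | apply hJ.mem | apply hN.mem | apply hW.mem | apply UTerm.single
    | apply UTerm.snoc | apply UTerm.var | apply UTerm.weaken | apply UDef.and | apply UDef.not
    | apply UDef.eq

lemma udef_code (hJ : UClass J) (hN : UClass N)
    (hW : UClass W) (hx : UTerm x) (hg : UTerm g) :
    UDef (fun M _ v => Code (J M) (N M) (W M) (x M v) (g M v)) := by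
  change UDef (fun M _ v => 
    (¬ x M v ∈ W M ∧ g M v = single (empt ⊢ₛ x M v)) ∨
    (∃ k y, InTower (J M) (N M) (W M) (x M v) k y ∧ g M v = single (succ k ⊢ₛ y)) ∨
    (x M v ∈ W M ∧ g M v = x M v ∧ ¬ ∃ k y, InTower (J M) (N M) (W M) (x M v) k y))
  repeat'
    first
    | assumption | apply hW.mem | apply udef_inTower hJ hN hW | apply UTerm.succ
    | apply UTerm.single | apply UTerm.snoc | apply UTerm.empt | apply UTerm.var
    | apply UTerm.weaken | apply UDef.and | apply UDef.or | apply UDef.not | apply UDef.ex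
    | apply UDef.eq

lemma uClass_inDomain (hJ : UClass J) (hN : UClass N) (hL : UClass L) :
    UClass (fun M _ => {f | InDomain (J M) (N M) (L M) f}) :=
  udef_inDomain hJ hN hL (.var 0)

lemma udef_isSnoc (hJ : UClass J) (hN : UClass N) (hL : UClass L)
    (hf : UTerm f) (hg : UTerm g) (hh : UTerm h) :
    UDef (fun M _ v => IsSnoc (J M) (N M) (L M) (f M v) (g M v) (h M v)) := by
  change UDef (fun M _ v => ∃ x ∈ J M,
    Code (J M) (N M) {f | InDomain (J M) (N M) (L M) f} x (g M v) ∧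
    IsCat (J M) (N M) (L M) (f M v) (single x) (h M v))
  repeat'
    first
    | assumption | apply hJ.mem | apply udef_code hJ hN (uClass_inDomain hJ hN hL)
    | apply udef_isCat hJ hN hL | apply UTerm.single | apply UTerm.var | apply UTerm.weaken
    | apply UDef.and | apply UDef.ex

end Definability

/-! ### From structures on the domain to interpretations -/

namespace Translation

variable {L L' : FirstOrder.Language.{0, 0}} (τ : Translation L L')
  {M : Type} [L'.Structure M]

/-- In `M`, the translation defines a function on the domain for every function symbol. -/
def DefinesFunctions (M : Type) [L'.Structure M] : Prop :=
  ∀ (n : ℕ) (f : L.Functions n) (xs : Fin n → τ.Dom M),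
    ∃! y : τ.Dom M, (τ.fn f).Realize (Fin.cons (y : M) fun i => (xs i : M))

variable {τ}

/-- The structure that a translation defines on its domain. -/
@[reducible]
noncomputable def DefinesFunctions.structure (h : τ.DefinesFunctions M) : L.Structure (τ.Dom M) where
  funMap f xs := (h _ f xs).choose
  RelMap R xs := (τ.rel R).Realize fun i => (xs i : M)

lemma realize_functional {n : ℕ} (f : L.Functions n) (h : τ.DefinesFunctions M) (v : Fin n → M) :
    (τ.functional f).Realize v := by
  simp only [functional, Formula.realize_imp, Formula.realize_iInf, Formula.realize_iExsUnique,
    Formula.realize_inf, realize_inDom, Formula.realize_relabel]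
  intro hv
  obtain ⟨y, hy, hu⟩ := h n f fun i => ⟨v i, hv i⟩
  have key : ∀ y : Unit → M, (Sum.elim v y ∘ Fin.cons (Sum.inr ()) Sum.inl : Fin (n + 1) → M) =
      Fin.cons (y ()) v := by
    intro y
    funext i
    refine Fin.cases ?_ (fun i => ?_) i <;> simp
  refine ⟨fun _ => y, ⟨y.2, by rw [key]; exact hy⟩, fun z hz => ?_⟩
  obtain ⟨hz₁, hz₂⟩ := hz
  rw [key] at hz₂
  funext u
  exact congr_arg Subtype.val (hu ⟨z (), hz₁⟩ hz₂)

/-- A translation is an interpretation if in every model of the theory it defines a model. -/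
theorem isInterpretation_of_models {T : L'.Theory} {U : L.Theory}
    (hdom : ∀ (M : Type) [L'.Structure M] [Nonempty M], M ⊨ T → (τ.Dom M).Nonempty)
    (hfun : ∀ (M : Type) [L'.Structure M] [Nonempty M], M ⊨ T → τ.DefinesFunctions M)
    (hmod : ∀ (M : Type) [L'.Structure M] [Nonempty M] [L.Structure (τ.Dom M)], M ⊨ T →
      (∀ (n : ℕ) (f : L.Functions n) (xs : Fin n → τ.Dom M) (y : τ.Dom M),
        (τ.fn f).Realize (Fin.cons (y : M) fun i => (xs i : M)) ↔ y = Structure.funMap f xs) →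
      τ.Dom M ⊨ U) : τ.IsInterpretation T U := by
  refine ⟨?_, ?_, ?_⟩
  · rw [Theory.models_sentence_iff]
    intro M
    obtain ⟨x, hx⟩ := hdom M M.is_model
    refine Formula.realize_iExs.2 ⟨fun _ => x, ?_⟩
    rw [realize_inDom]
    exact hx
  · intro n f
    rw [Theory.models_formula_iff]
    intro M v
    exact realize_functional f (hfun M M.is_model) v
  · intro φ hφ
    rw [Theory.models_sentence_iff]
    intro M
    have hF := hfun M M.is_model
    let _ := hF.structure
    have hf : ∀ (n : ℕ) (f : L.Functions n) (xs : Fin n → τ.Dom M) (y : τ.Dom M),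
        (τ.fn f).Realize (Fin.cons (y : M) fun i => (xs i : M)) ↔ y = Structure.funMap f xs := by
      intro n f xs y
      have hc := (hF n f xs).choose_spec
      constructor
      · exact fun h => hc.2 y h
      · rintro rfl
        exact hc.1
    have h := (hmod M M.is_model hf).realize_of_mem φ hφ
    have := (realize_translate τ hf (fun _ _ _ => Iff.rfl) φ default default).2 h
    unfold Sentence.Realize Formula.Realize
    convert this using 1

end Translation

/-- The formulas that define the graphs of the operations, from one formula for each symbol. -/
def graphs (φe : LSeq.Formula (Fin 1)) (φsnoc φcat : LSeq.Formula (Fin 3)) :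
    ∀ {n : ℕ}, SeqFunc n → LSeq.Formula (Fin (n + 1))
  | _, .e => φe
  | _, .snoc => φsnoc
  | _, .cat => φcat

theorem lenSetting (M : Type) [LSeq.Structure M] [SeqModel M] :
    LenSetting (starClass M) (numClass M) (lenClass (starClass M) (numClass M)) where
  toSetting := setting_starClass M
  sub := isSubdomain_lenClass M
  good _ := lenClass_segGood

end SeqInterp

/-! ### The interpretation -/

open SeqInterp in
theorem mainTheorem7 :
    ∃ (τ : SeqInterp.Translation SeqInterp.LSeq SeqInterp.LSeq)
      (J N Nstar : SeqInterp.LSeq.Formula (Fin 1)),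
      τ.IsInterpretation SeqInterp.Seq SeqInterp.SeqPlus ∧
      ∀ (M : Type) [SeqInterp.LSeq.Structure M] [Nonempty M] [M ⊨ SeqInterp.Seq],
        let 𝒥 : Set M := SeqInterp.classOf M J
        let 𝒩 : Set M := SeqInterp.classOf M N
        let 𝒩s : Set M := SeqInterp.classOf M Nstar
        let D : Set M := SeqInterp.classOf M τ.dom
        SeqInterp.IsStarClass 𝒥 ∧
        SeqInterp.IsNumberClass 𝒥 𝒩 ∧
        SeqInterp.IsSubdomain 𝒩 𝒩s ∧
        (∀ f : M, f ∈ D ↔ SeqInterp.InDomain 𝒥 𝒩 𝒩s f) ∧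
        (∀ h ∈ D, (τ.fn SeqInterp.SeqFunc.e).Realize ![h] ↔ h = SeqInterp.empt) ∧
        (∀ f ∈ D, ∀ g ∈ D, ∀ h ∈ D, (τ.fn SeqInterp.SeqFunc.cat).Realize ![h, f, g] ↔
          SeqInterp.IsConcatE 𝒥 𝒩 𝒩s f g h) ∧
        (∀ f ∈ D, ∀ g ∈ D, ∀ h ∈ D, (τ.fn SeqInterp.SeqFunc.snoc).Realize ![h, f, g] →
          ∃ x ∈ 𝒥, SeqInterp.IsConcatE 𝒥 𝒩 𝒩s f (SeqInterp.single x) h) := by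
  have hJ := uClass_starClass
  have hN := uClass_numClass
  have hL := uClass_lenClass hJ hN
  obtain ⟨φJ, hφJ⟩ := id hJ
  obtain ⟨φN, hφN⟩ := id hN
  obtain ⟨φL, hφL⟩ := id hL
  obtain ⟨φD, hφD⟩ := uClass_inDomain hJ hN hL
  obtain ⟨φe, hφe⟩ := UDef.eq (α := Fin 1) (.var 0) .empt
  -- In a graph formula variable `0` is the value, and `1`, `2` are the arguments.
  obtain ⟨φc, hφc⟩ := udef_isCat (α := Fin 3) hJ hN hL (.var 1) (.var 2) (.var 0)
  obtain ⟨φs, hφs⟩ := udef_isSnoc (α := Fin 3) hJ hN hL (.var 1) (.var 2) (.var 0)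
  let τ : Translation LSeq LSeq := ⟨φD, graphs φe φs φc, nofun⟩
  have dom : ∀ (M : Type) [LSeq.Structure M] (x : M), x ∈ τ.Dom M ↔
      InDomain (starClass M) (numClass M) (lenClass (starClass M) (numClass M)) x :=
    fun M _ x => hφD M fun _ => x
  refine ⟨τ, φJ, φN, φL, ?_, ?_⟩
  · refine Translation.isInterpretation_of_models ?_ ?_ ?_
    · intro M _ _ _
      exact ⟨empt, (dom M empt).2 (.inl rfl)⟩
    · intro M _ _ hM
      have := seqModel_of_models hM
      have H := lenSetting M
      rintro n (_ | _ | _) xs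
      · refine ⟨⟨empt, (dom M _).2 (.inl rfl)⟩, (hφe M _).2 rfl, fun y hy => ?_⟩
        exact Subtype.ext ((hφe M _).1 hy)
      · obtain ⟨h, hh⟩ := H.exists_isSnoc ((dom M _).1 (xs 0).2) ((dom M _).1 (xs 1).2)
        refine ⟨⟨h, (dom M _).2 (H.isSnoc_inDomain hh)⟩, (hφs M _).2 hh, fun y hy => ?_⟩
        exact Subtype.ext (H.isSnoc_unique ((hφs M _).1 hy) hh)
      · obtain ⟨h, hh⟩ := H.exists_isCat ((dom M _).1 (xs 0).2) ((dom M _).1 (xs 1).2)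
        refine ⟨⟨h, (dom M _).2 (H.isCat_inDomain hh)⟩, (hφc M _).2 hh, fun y hy => ?_⟩
        exact Subtype.ext (H.isCat_unique ((hφc M _).1 hy) hh)
    · intro M _ _ _ hM hf
      have := seqModel_of_models hM
      refine (lenSetting M).models_seqPlus (i := Subtype.val) Subtype.val_injective
        (fun x => (dom M x).1 x.2) (fun f hD => ⟨⟨f, (dom M f).2 hD⟩, rfl⟩) ?_ ?_ ?_
      · exact (hφe M _).1 ((hf 0 SeqFunc.e ![] _).2 rfl)
      · exact fun x y => (hφc M _).1 ((hf 2 SeqFunc.cat ![x, y] _).2 rfl)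
      · exact fun x y => (hφs M _).1 ((hf 2 SeqFunc.snoc ![x, y] _).2 rfl)
  · intro M _ _ hM
    have := seqModel_of_models hM
    have H := lenSetting M
    have eJ : classOf M φJ = starClass M := Set.ext fun x => hφJ M fun _ => x
    have eN : classOf M φN = numClass M := Set.ext fun x => hφN M fun _ => x
    have eL : classOf M φL = lenClass (starClass M) (numClass M) :=
      Set.ext fun x => hφL M fun _ => x
    have eD : ∀ x, x ∈ classOf M τ.dom ↔
      InDomain (starClass M) (numClass M) (lenClass (starClass M) (numClass M)) x := dom M
    intro 𝒥 𝒩 𝒩s D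
    simp only [𝒥, 𝒩, 𝒩s, D, eJ, eN, eL, eD]
    refine ⟨H.star, H.num, H.sub, fun _ => trivial, fun h _ => hφe M _, ?_, ?_⟩
    · intro f hf g hg h _
      -- The graph of `∘` was defined through `IsCat`, which on the domain agrees with concatenation
      -- as described by closed intervals.
      rw [H.isConcatE_iff hf hg]
      exact hφc M _
    · intro f hf g hg h _ hs
      obtain ⟨x, hx, -, hc⟩ := (hφs M _).1 hs
      exact ⟨x, hx, (H.isConcatE_iff hf (H.single_inDomain hx)).2 hc⟩
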